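/- A \emph{contextuality scenario} is a pair $\mathbb G=(V,E)$, where $V$ is a finite set and $E$ is a non-empty set of subsets of $V$ with $\bigcup_{e\in E}e=V$. A \emph{probabilistic model} of $\mathbb G$ is a map $p:V\to[0,1]$ with $\sum_{x\in e}p(x)=1$ for all $e\in E$; $\mathcal G(\mathbb G)$ is the set of these, and $\mathbb G$ is \emph{non-trivial} if $\mathcal G(\mathbb G)\neq\emptyset$. A \emph{positive operator representation} (POR) of $\mathbb G$ on a Hilbert space $H$ is a family $(A_x)_{x\in V}$ of positive operators in $\mathcal B(H)$ with $\sum_{x\in e}A_x=I$ for all $e\in E$. \textbf{Models.} Let $\mathbb G=(V,E)$ and $\mathbb H=(W,F)$ be non-trivial contextuality scenarios, and let $\mathcal G(\mathbb G,\mathbb H)$ be the set of probabilistic models of the scenario $(V\times W,\{e\times f:e\in E,f\in F\})$. Such a model $p$ is \emph{no-signalling} if $\sum_{x\in e}p(x,y)$ does not depend on $e\in E$ and $\sum_{y\in f}p(x,y)$ does not depend on $f\in F$, for all $y\in W$, $x\in V$. Let $\tilde{\mathcal Q}_{\rm qc}(\mathbb G,\mathbb H)$ be the set of no-signalling models of the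 form $p(x,y)=\langle A_xB_y\xi,\xi\rangle$, where $(A_x)_{x\in V}$, $(B_y)_{y\in W}$ are PORs of $\mathbb G$, $\mathbb H$ on a common Hilbert space with $A_xB_y=B_yA_x$ for all $x,y$, and $\xi$ is a unit vector. Let $\tilde{\mathcal Q}_{\rm q}(\mathbb G,\mathbb H)$ be the set of no-signalling models of the form $p(x,y)=\langle (A_x\otimes B_y)\xi,\xi\rangle$, where $(A_x)$, $(B_y)$ are PORs of $\mathbb G$, $\mathbb H$ on finite dimensional Hilbert spaces $H_1$, $H_2$ and $\xi\in H_1\otimes H_2$ is a unit vector, and let $\tilde{\mathcal Q}_{\rm qa}(\mathbb G,\mathbb H)$ be its closure in $\mathbb R^{V\times W}$. \textbf{Operator systems.} Let $\mathcal S_{\mathbb G}$ be the operator system quotient of $\mathcal S=\bigoplus_{e\in E}\ell^\infty_e$ by $\tilde{\mathcal J}=\{u:\sum_{e\in E}\sum_{x\in e}p(x)u^e_x=0\text{ for all }p\in\mathcal G(\mathbb G)\}$; that is, a matrix over $\mathcal S/\tilde{\mathcal J}$ is positive if for every $\varepsilon>0$ it has a representative $u$ over $\mathcal S$ with $u+\varepsilon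 1\ge0$. Let $a_x$ be the image in $\mathcal S_{\mathbb G}$ of $|E|\,\delta^e_x$, where $\delta_x^e$ is the canonical basis vector of $\ell^\infty_e$; it does not depend on the choice of $e\in E$ with $x\in e$. Let $b_y\in\mathcal S_{\mathbb H}$, $y\in W$, be defined in the same way. The cones of the commuting tensor product $\mathcal S_{\mathbb G}\otimes_{\rm c}\mathcal S_{\mathbb H}$ consist of the matrices over the algebraic tensor product whose images under $\phi\cdot\psi$, $(\phi\cdot\psi)(a\otimes b)=\phi(a)\psi(b)$, are positive for all unital completely positive maps $\phi$, $\psi$ of $\mathcal S_{\mathbb G}$, $\mathcal S_{\mathbb H}$ into a common $\mathcal B(H)$ with commuting ranges; those of the minimal tensor product $\mathcal S_{\mathbb G}\otimes_{\min}\mathcal S_{\mathbb H}$ consist of the matrices whose images under $\phi\otimes\psi$ are positive for all unital completely positive $\phi:\mathcal S_{\mathbb G}\to M_k$, $\psi:\mathcal S_{\mathbb H}\to M_l$, $k,l\in\mathbb N$. A \emph{state} is a unital positive linear functional. \textbf{C*-algebras.} Let $(v_x)_{x\in V}$ be the direct sum of all families $(U_x)_{x\in V}$ of bounded operators $U_x:H\to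 H'$ between Hilbert spaces of dimension at most the continuum (up to unitary equivalence) with $\sum_{x\in e}U_x^*U_x=I_H$ for all $e\in E$. Put $g_{x,x'}=v_x^*v_{x'}$ and let $\mathcal B_{\mathbb G}$ be the C*-algebra generated by $\{g_{x,x}:x\in V\}$; define $\mathcal B_{\mathbb H}$ in the same way, with generators $h_{y,y}$, $y\in W$. Let $\otimes_{\max}$ and $\otimes_{\min}$ also denote the maximal and the minimal (spatial) tensor product of C*-algebras. For a functional $s$ on $\mathcal S_{\mathbb G}\otimes\mathcal S_{\mathbb H}$ write $p^s(x,y)=s(a_x\otimes b_y)$, and for a functional $s$ on $\mathcal B_{\mathbb G}\otimes_{\max}\mathcal B_{\mathbb H}$ or $\mathcal B_{\mathbb G}\otimes_{\min}\mathcal B_{\mathbb H}$ write $p^s(x,y)=s(g_{x,x}\otimes h_{y,y})$, $x\in V$, $y\in W$. \textbf{Theorem.} Let $\mathbb G$, $\mathbb H$ be non-trivial contextuality scenarios and $p\in\mathcal G(\mathbb G,\mathbb H)$. The following are equivalent: \begin{enumerate} \item $p\in\tilde{\mathcal Q}_{\rm qc}(\mathbb G,\mathbb H)$ (resp. $p\in\tilde{\mathcal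 Q}_{\rm qa}(\mathbb G,\mathbb H)$); \item there is a state $s$ on $\mathcal S_{\mathbb G}\otimes_{\rm c}\mathcal S_{\mathbb H}$ (resp. $\mathcal S_{\mathbb G}\otimes_{\min}\mathcal S_{\mathbb H}$) with $p=p^s$; \item there is a state $s$ on $\mathcal B_{\mathbb G}\otimes_{\max}\mathcal B_{\mathbb H}$ (resp. $\mathcal B_{\mathbb G}\otimes_{\min}\mathcal B_{\mathbb H}$) with $p=p^s$. \end{enumerate} Moreover, $s\mapsto p^s$ is an affine isomorphism from the state space of $\mathcal S_{\mathbb G}\otimes_{\rm c}\mathcal S_{\mathbb H}$ (resp. $\mathcal S_{\mathbb G}\otimes_{\min}\mathcal S_{\mathbb H}$) onto $\tilde{\mathcal Q}_{\rm qc}(\mathbb G,\mathbb H)$ (resp. $\tilde{\mathcal Q}_{\rm qa}(\mathbb G,\mathbb H)$). -/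

import Mathlib

open scoped TensorProduct ComplexOrder ENNReal

noncomputable section

namespace Contextuality

/-! ### Contextuality scenarios and probabilistic models -/

/-- A contextuality scenario: a hypergraph on a (finite) vertex set `V` with a non-empty set of
hyperedges that covers `V`. -/
structure Scenario (V : Type) where
  edges : Finset (Finset V)
  nonempty : edges.Nonempty
  covers : ∀ x : V, ∃ e ∈ edges, x ∈ e

variable {V W : Type}

/-- The set of probabilistic models of a scenario. -/
def Scenario.models (G : Scenario V) : Set (V → ℝ) :=
  {p | (∀ x, p x ∈ Set.Icc (0 : ℝ) 1) ∧ ∀ e ∈ G.edges, ∑ x ∈ e, p x = 1}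

/-- A scenario is non-trivial if it admits a probabilistic model. -/
def Scenario.IsNontrivial (G : Scenario V) : Prop := G.models.Nonempty

/-- The product scenario, on the vertex set `V × W`, with hyperedges `e × f`. -/
def Scenario.prod (G : Scenario V) (K : Scenario W) : Scenario (V × W) := by
  classical
  exact
    { edges := Finset.image₂ (fun e f => e ×ˢ f) G.edges K.edges
      nonempty := G.nonempty.image₂ K.nonempty
      covers := by
        rintro ⟨x, y⟩
        obtain ⟨e, he, hx⟩ := G.covers x
        obtain ⟨f, hf, hy⟩ := K.covers y
        exact ⟨e ×ˢ f, Finset.mem_image₂_of_mem he hf, Finset.mk_mem_product hx hy⟩ }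

/-- The no-signalling probabilistic models of the product scenario. -/
def noSignalling (G : Scenario V) (K : Scenario W) : Set (V × W → ℝ) :=
  {p | p ∈ (G.prod K).models ∧
    (∀ y, ∀ e ∈ G.edges, ∀ e' ∈ G.edges, ∑ x ∈ e, p (x, y) = ∑ x ∈ e', p (x, y)) ∧
    (∀ x, ∀ f ∈ K.edges, ∀ f' ∈ K.edges, ∑ y ∈ f, p (x, y) = ∑ y ∈ f', p (x, y))}

/-- A positive operator representation (POR) of the scenario `G` on the Hilbert space `H`. -/
def IsPOR {H : Type} [NormedAddCommGroup H] [InnerProductSpace ℂ H]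
    (G : Scenario V) (A : V → H →L[ℂ] H) : Prop :=
  (∀ x, (A x).IsPositive) ∧ ∀ e ∈ G.edges, ∑ x ∈ e, A x = 1

/-- The generalised commuting probabilistic models `Q̃_qc(G, K)`. -/
def genQC (G : Scenario V) (K : Scenario W) : Set (V × W → ℝ) :=
  {p | p ∈ noSignalling G K ∧
    ∃ (H : Type) (_ : NormedAddCommGroup H) (_ : InnerProductSpace ℂ H) (_ : CompleteSpace H)
      (A : V → H →L[ℂ] H) (B : W → H →L[ℂ] H) (ξ : H),
      IsPOR G A ∧ IsPOR K B ∧ (∀ x y, A x * B y = B y * A x) ∧ ‖ξ‖ = 1 ∧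
      ∀ x y, (p (x, y) : ℂ) = inner ℂ ξ ((A x * B y) ξ)}

/-- The generalised tensor probabilistic models `Q̃_q(G, K)` over finite dimensional Hilbert
spaces. (The algebraic tensor product of finite dimensional Hilbert spaces is complete.) -/
def genQ (G : Scenario V) (K : Scenario W) : Set (V × W → ℝ) :=
  {p | p ∈ noSignalling G K ∧
    ∃ (H₁ : Type) (_ : NormedAddCommGroup H₁) (_ : InnerProductSpace ℂ H₁)
      (H₂ : Type) (_ : NormedAddCommGroup H₂) (_ : InnerProductSpace ℂ H₂)
      (A : V → H₁ →L[ℂ] H₁) (B : W → H₂ →L[ℂ] H₂) (ξ : H₁ ⊗[ℂ] H₂),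
      FiniteDimensional ℂ H₁ ∧ FiniteDimensional ℂ H₂ ∧
      IsPOR G A ∧ IsPOR K B ∧ ‖ξ‖ = 1 ∧
      ∀ x y, (p (x, y) : ℂ) =
        inner ℂ ξ ((TensorProduct.mapL (A x) (1 : H₂ →L[ℂ] H₂) *
          TensorProduct.mapL (1 : H₁ →L[ℂ] H₁) (B y)) ξ)}

/-- The generalised approximately quantum models `Q̃_qa(G, K)`: the closure of `Q̃_q(G, K)`. -/
def genQA (G : Scenario V) (K : Scenario W) : Set (V × W → ℝ) := closure (genQ G K)

/-! ### Matrix orders, completely positive maps, states, quotients and tensor products -/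

/-- The order data of an operator system: the unit and the cones `M_n(S)⁺`. The elements of the
cones are hermitian in every operator system, so that the involution is not recorded; it plays no
role for positive functionals and completely positive maps. -/
structure MatrixOrder (S : Type) [AddCommGroup S] [Module ℂ S] where
  one : S
  cone : ∀ n : ℕ, Set (Matrix (Fin n) (Fin n) S)

section OperatorSystems

variable {S T : Type} [AddCommGroup S] [Module ℂ S] [AddCommGroup T] [Module ℂ T]

/-- The states: the unital linear functionals that are positive on `S⁺ = M_1(S)⁺`. -/
def MatrixOrder.states (O : MatrixOrder S) : Set (S →ₗ[ℂ] ℂ) :=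
  {s | s O.one = 1 ∧ ∀ a : S, (Matrix.of fun _ _ : Fin 1 => a) ∈ O.cone 1 → 0 ≤ s a}

/-- Positivity of a matrix `[T i j]` of bounded operators on `H`, as an operator on `Hⁿ`. -/
def IsPositiveOpMatrix {H : Type} [NormedAddCommGroup H] [InnerProductSpace ℂ H] {n : ℕ}
    (M : Matrix (Fin n) (Fin n) (H →L[ℂ] H)) : Prop :=
  ∀ ξ : Fin n → H, 0 ≤ ∑ i, ∑ j, inner ℂ (ξ i) (M i j (ξ j))

/-- Unital completely positive maps from an operator system into `B(H)`. -/
def MatrixOrder.IsUCP {H : Type} [NormedAddCommGroup H] [InnerProductSpace ℂ H]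
    (O : MatrixOrder S) (φ : S →ₗ[ℂ] H →L[ℂ] H) : Prop :=
  φ O.one = 1 ∧ ∀ n, ∀ M ∈ O.cone n, IsPositiveOpMatrix (M.map φ)

/-- The operator system quotient `S/J`: a matrix is positive if, for every `ε > 0`, it has a
representative `u` over `S` with `u + ε 1` positive. -/
def MatrixOrder.quotient (O : MatrixOrder S) (J : Submodule ℂ S) : MatrixOrder (S ⧸ J) where
  one := J.mkQ O.one
  cone n := {M | ∀ ε : ℝ, 0 < ε → ∃ u : Matrix (Fin n) (Fin n) S,
    u.map J.mkQ = M ∧ (u + Matrix.diagonal fun _ => (ε : ℂ) • O.one) ∈ O.cone n}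

/-- The map `φ · ψ : S ⊗ T → B(H)`, `a ⊗ b ↦ φ(a) ψ(b)`. -/
def opProd {H : Type} [NormedAddCommGroup H] [InnerProductSpace ℂ H]
    (φ : S →ₗ[ℂ] H →L[ℂ] H) (ψ : T →ₗ[ℂ] H →L[ℂ] H) : S ⊗[ℂ] T →ₗ[ℂ] H →L[ℂ] H :=
  LinearMap.mul' ℂ (H →L[ℂ] H) ∘ₗ TensorProduct.map φ ψ

/-- The map `φ ⊗ ψ : S ⊗ T → B(H₁ ⊗ H₂)`, `a ⊗ b ↦ φ(a) ⊗ ψ(b)`. -/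
def opTensor {H₁ H₂ : Type} [NormedAddCommGroup H₁] [InnerProductSpace ℂ H₁]
    [NormedAddCommGroup H₂] [InnerProductSpace ℂ H₂]
    (φ : S →ₗ[ℂ] H₁ →L[ℂ] H₁) (ψ : T →ₗ[ℂ] H₂ →L[ℂ] H₂) :
    S ⊗[ℂ] T →ₗ[ℂ] (H₁ ⊗[ℂ] H₂ →L[ℂ] H₁ ⊗[ℂ] H₂) :=
  TensorProduct.lift (LinearMap.mk₂ ℂ (fun a b => TensorProduct.mapL (φ a) (ψ b))
    (fun _ _ _ => by rw [map_add, TensorProduct.mapL_add_left])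
    (fun _ _ _ => by rw [map_smul, TensorProduct.mapL_smul_left])
    (fun _ _ _ => by rw [map_add, TensorProduct.mapL_add_right])
    (fun _ _ _ => by rw [map_smul, TensorProduct.mapL_smul_right]))

/-- The commuting tensor product `S ⊗_c T`: a matrix over `S ⊗ T` is positive if its image under
`φ · ψ` is positive for all unital completely positive maps `φ`, `ψ` into a common `B(H)` with
commuting ranges. -/
def MatrixOrder.commTensor (O : MatrixOrder S) (P : MatrixOrder T) : MatrixOrder (S ⊗[ℂ] T) where
  one := O.one ⊗ₜ P.one
  cone _ := {M | ∀ (H : Type) [NormedAddCommGroup H] [InnerProductSpace ℂ H] [CompleteSpace H]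
    (φ : S →ₗ[ℂ] H →L[ℂ] H) (ψ : T →ₗ[ℂ] H →L[ℂ] H), O.IsUCP φ → P.IsUCP ψ →
    (∀ a b, φ a * ψ b = ψ b * φ a) → IsPositiveOpMatrix (M.map (opProd φ ψ))}

/-- The minimal tensor product `S ⊗_min T`: a matrix over `S ⊗ T` is positive if its image under
`φ ⊗ ψ` is positive for all unital completely positive `φ : S → M_k`, `ψ : T → M_l`. -/
def MatrixOrder.minTensor (O : MatrixOrder S) (P : MatrixOrder T) : MatrixOrder (S ⊗[ℂ] T) where
  one := O.one ⊗ₜ P.one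
  cone _ := {M | ∀ (k l : ℕ)
    (φ : S →ₗ[ℂ] EuclideanSpace ℂ (Fin k) →L[ℂ] EuclideanSpace ℂ (Fin k))
    (ψ : T →ₗ[ℂ] EuclideanSpace ℂ (Fin l) →L[ℂ] EuclideanSpace ℂ (Fin l)),
    O.IsUCP φ → P.IsUCP ψ → IsPositiveOpMatrix (M.map (opTensor φ ψ))}

end OperatorSystems

/-! ### The universal operator system `S_G` -/

/-- The underlying vector space of `⊕_{e ∈ E} ℓ^∞_e`. -/
abbrev Scenario.LInfSum (G : Scenario V) : Type := (e : G.edges) → (e.1 → ℂ)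

/-- The operator system `⊕_{e ∈ E} ℓ^∞_e`, with `M_n(⊕_e ℓ^∞_e) = ⊕_e ⊕_{x ∈ e} M_n`. -/
def Scenario.lInfOrder (G : Scenario V) : MatrixOrder G.LInfSum where
  one := 1
  cone _ := {u | ∀ (e : G.edges) (x : e.1), (u.map fun v => v e x).PosSemidef}

/-- The kernel `J̃ = {u : ⟨p, u⟩ = 0 for every probabilistic model p}`. -/
def Scenario.kernel (G : Scenario V) : Submodule ℂ G.LInfSum where
  carrier := {u | ∀ p ∈ G.models, ∑ e : G.edges, ∑ x : e.1, (p x : ℂ) * u e x = 0}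
  zero_mem' := by intro p _; simp
  add_mem' := by
    intro u v hu hv p hp
    simp only [Pi.add_apply, mul_add, Finset.sum_add_distrib]
    rw [hu p hp, hv p hp, add_zero]
  smul_mem' := by
    intro c u hu p hp
    simp only [Pi.smul_apply, smul_eq_mul, mul_left_comm _ c]
    simp only [← Finset.mul_sum]
    rw [hu p hp, mul_zero]

/-- The vector space underlying `S_G = (⊕_e ℓ^∞_e) / J̃`. -/
abbrev Scenario.SG (G : Scenario V) : Type := G.LInfSum ⧸ G.kernel

/-- The universal operator system `S_G`. -/
def Scenario.sgOrder (G : Scenario V) : MatrixOrder G.SG := G.lInfOrder.quotient G.kernel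

/-- The element `|E| q(δ_x^e)` of `S_G`, for `x ∈ e ∈ E`. -/
def Scenario.genOf (G : Scenario V) (e : G.edges) (x : e.1) : G.SG := by
  classical
  exact (G.edges.card : ℂ) • G.kernel.mkQ (Pi.single e (Pi.single x 1))

/-- The element `|E| q(δ_x^e)` depends on `x` only. -/
theorem Scenario.genOf_eq (G : Scenario V) (e f : G.edges) (x : V) (he : x ∈ e.1)
    (hf : x ∈ f.1) : G.genOf e ⟨x, he⟩ = G.genOf f ⟨x, hf⟩ := by
  classical
  have key : ∀ (e : G.edges) (he : x ∈ e.1) (p : V → ℝ),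
      ∑ e' : G.edges, ∑ y : e'.1, (p y : ℂ) *
        (Pi.single e (Pi.single ⟨x, he⟩ 1) : G.LInfSum) e' y = p x := by
    intro e he p
    rw [Finset.sum_eq_single e]
    · simp [Pi.single_apply]
    · intro e' _ hne
      simp [Pi.single_eq_of_ne hne]
    · simp
  unfold Scenario.genOf
  congr 1
  refine (Submodule.Quotient.eq _).2 ?_
  intro p hp
  simp only [Pi.sub_apply, mul_sub, Finset.sum_sub_distrib]
  rw [key e he p, key f hf p, sub_self]

/-- The canonical generators `a_x` of `S_G`. -/
def Scenario.gen (G : Scenario V) (x : V) : G.SG :=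
  G.genOf ⟨(G.covers x).choose, (G.covers x).choose_spec.1⟩ ⟨x, (G.covers x).choose_spec.2⟩

/-- For a functional `s` on `S_G ⊗ S_K`, the function `p^s(x, y) = s(a_x ⊗ b_y)`. -/
def pState (G : Scenario V) (K : Scenario W) (s : G.SG ⊗[ℂ] K.SG →ₗ[ℂ] ℂ) : V × W → ℂ :=
  fun z => s (G.gen z.1 ⊗ₜ K.gen z.2)

/-! ### Direct sums of C*-algebras of operators, and the C*-algebra `B_G` -/

/-- The bounded diagonal operators on the direct sum of the Hilbert spaces `H i`, as the
C*-algebra `ℓ^∞-⊕ B(H i)`. -/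
def DiagOp {I : Type*} (H : I → Type*) [∀ i, NormedAddCommGroup (H i)]
    [∀ i, InnerProductSpace ℂ (H i)] : Type _ := lp (fun i => H i →L[ℂ] H i) ∞

section DiagOp

variable {I : Type*} (H : I → Type*) [∀ i, NormedAddCommGroup (H i)]
  [∀ i, InnerProductSpace ℂ (H i)]

instance [∀ i, CompleteSpace (H i)] [∀ i, Nontrivial (H i)] : CStarAlgebra (DiagOp H) :=
  { (inferInstance : NormedRing (lp (fun i => H i →L[ℂ] H i) ∞)),
    (inferInstance : StarRing (lp (fun i => H i →L[ℂ] H i) ∞)),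
    (inferInstance : CompleteSpace (lp (fun i => H i →L[ℂ] H i) ∞)),
    (inferInstance : CStarRing (lp (fun i => H i →L[ℂ] H i) ∞)),
    (inferInstance : NormedAlgebra ℂ (lp (fun i => H i →L[ℂ] H i) ∞)),
    (inferInstance : StarModule ℂ (lp (fun i => H i →L[ℂ] H i) ∞)) with }

variable {H}

/-- The direct sum of a bounded family of operators. -/
def DiagOp.mk (T : ∀ i, H i →L[ℂ] H i) (c : ℝ) (hT : ∀ i, ‖T i‖ ≤ c) : DiagOp H :=
  (⟨T, memℓp_infty ⟨c, by rintro _ ⟨i, rfl⟩; exact hT i⟩⟩ : lp (fun i => H i →L[ℂ] H i) ∞)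

/-- The `i`-th component of a diagonal operator. -/
def DiagOp.apply (T : DiagOp H) (i : I) : H i →L[ℂ] H i :=
  (show lp (fun i => H i →L[ℂ] H i) ∞ from T) i

theorem DiagOp.ext {S T : DiagOp H} (h : ∀ i, S.apply i = T.apply i) : S = T :=
  lp.ext (E := fun i => H i →L[ℂ] H i) (p := ∞) (funext h)

end DiagOp

/-- The unital C*-subalgebra of `A` generated by a set. -/
def cstarGen {A : Type*} [CStarAlgebra A] (X : Set A) : StarSubalgebra ℂ A :=
  (StarAlgebra.adjoin ℂ X).topologicalClosure

instance {A : Type*} [CStarAlgebra A] (X : Set A) : IsClosed (cstarGen X : Set A) :=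
  StarSubalgebra.isClosed_topologicalClosure _

instance {A : Type*} [CStarAlgebra A] (X : Set A) : CStarAlgebra (cstarGen X) :=
  StarSubalgebra.cstarAlgebra (cstarGen X)

theorem subset_cstarGen {A : Type*} [CStarAlgebra A] (X : Set A) : X ⊆ cstarGen X := fun _ h =>
  StarSubalgebra.le_topologicalClosure _ (StarAlgebra.subset_adjoin ℂ X h)

/-- The Hilbert space `ℓ²(D)`, for a set `D` of real numbers. -/
def L2 (D : Set ℝ) : Type := lp (fun _ : D => ℂ) 2

instance (D : Set ℝ) : NormedAddCommGroup (L2 D) :=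
  inferInstanceAs (NormedAddCommGroup (lp (fun _ : D => ℂ) 2))

instance (D : Set ℝ) : InnerProductSpace ℂ (L2 D) :=
  inferInstanceAs (InnerProductSpace ℂ (lp (fun _ : D => ℂ) 2))

instance (D : Set ℝ) : CompleteSpace (L2 D) :=
  inferInstanceAs (CompleteSpace (lp (fun _ : D => ℂ) 2))

/-- A family `(U_x)` of operators `ℓ²(dom) → ℓ²(cod)` with `∑_{x ∈ e} U_x* U_x = 1` for every
hyperedge `e`, that is, a non-degenerate representation of the universal ternary ring of `G`. This
ring has the cardinality of the continuum, and every Hilbert space whose dimension is at most that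
is `ℓ²(D)` for a subset `D` of `ℝ`, up to unitary equivalence. -/
structure Scenario.TernaryRep (G : Scenario V) where
  dom : Set ℝ
  cod : Set ℝ
  dom_nonempty : dom.Nonempty
  U : V → L2 dom →L[ℂ] L2 cod
  sum_eq : ∀ e ∈ G.edges, ∑ x ∈ e, (ContinuousLinearMap.adjoint (U x)) ∘L (U x) = 1

/-- The space on which the right C*-algebra of the representation acts. -/
abbrev Scenario.TernaryRep.space {G : Scenario V} (θ : G.TernaryRep) : Type := L2 θ.dom

instance {G : Scenario V} (θ : G.TernaryRep) : Nontrivial θ.space := by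
  obtain ⟨t, ht⟩ := θ.dom_nonempty
  classical
  refine ⟨⟨(lp.single 2 (⟨t, ht⟩ : θ.dom) (1 : ℂ) : lp (fun _ : θ.dom => ℂ) 2), 0, fun h => ?_⟩⟩
  have := congrArg (fun f : lp (fun _ : θ.dom => ℂ) 2 => f ⟨t, ht⟩) h
  simp at this
  exact one_ne_zero this

theorem Scenario.TernaryRep.norm_le {G : Scenario V} (θ : G.TernaryRep) (x : V) :
    ‖θ.U x‖ ≤ 1 := by
  obtain ⟨e, he, hx⟩ := G.covers x
  refine ContinuousLinearMap.opNorm_le_bound _ zero_le_one fun ξ => ?_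
  have h1 : ∑ y ∈ e, ‖θ.U y ξ‖ ^ 2 = ‖ξ‖ ^ 2 := by
    have h := congrArg (fun T : θ.space →L[ℂ] θ.space => RCLike.re (inner ℂ (T ξ) ξ))
      (θ.sum_eq e he)
    simp only [sum_apply, ContinuousLinearMap.comp_apply, sum_inner,
      ContinuousLinearMap.adjoint_inner_left, one_apply_eq_self, map_sum,
      inner_self_eq_norm_sq] at h
    exact h
  have h2 : ‖θ.U x ξ‖ ^ 2 ≤ ‖ξ‖ ^ 2 := by
    rw [← h1]
    exact Finset.single_le_sum (f := fun y => ‖θ.U y ξ‖ ^ 2) (fun _ _ => sq_nonneg _) hx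
  rw [one_mul]
  exact (sq_le_sq₀ (norm_nonneg _) (norm_nonneg _)).1 h2

/-- The element `g_{x,x'} = v_x* v_{x'}`, where `v_x = ⊕_θ θ(v_x)` is the canonical generator of the
universal ternary ring of operators of `G`, realised by the direct sum of all representations. -/
def Scenario.g (G : Scenario V) (x x' : V) : DiagOp (fun θ : G.TernaryRep => θ.space) :=
  DiagOp.mk (fun θ => (ContinuousLinearMap.adjoint (θ.U x)) ∘L (θ.U x')) 1 fun θ => by
    refine (ContinuousLinearMap.opNorm_comp_le _ _).trans ?_
    rw [LinearIsometryEquiv.norm_map]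
    exact mul_le_one₀ (θ.norm_le x) (norm_nonneg _) (θ.norm_le x')

/-- The C*-algebra `B_G`, generated by the elements `g_{x,x}`, `x ∈ V`, inside the right C*-algebra
of the universal ternary ring of operators (the closed span of the products `S* T`), which is itself
a subalgebra of the ambient algebra of diagonal operators. -/
abbrev Scenario.BG (G : Scenario V) :
    StarSubalgebra ℂ (DiagOp (fun θ : G.TernaryRep => θ.space)) :=
  cstarGen (Set.range fun x => G.g x x)

/-- The generator `g_{x,x}` as an element of `B_G`. -/
def Scenario.bgen (G : Scenario V) (x : V) : G.BG :=
  ⟨G.g x x, subset_cstarGen _ (Set.mem_range_self x)⟩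

/-! ### Tensor products of C*-algebras -/

/-- The states of a unital C*-algebra. -/
def cstarStates (A : Type*) [CStarAlgebra A] : Set (A →ₗ[ℂ] ℂ) :=
  {f | f 1 = 1 ∧ ∀ a, 0 ≤ f (star a * a)}

/-- A pair of unital *-representations of `A` and `B` on a common Hilbert space with commuting
ranges. -/
structure CommRep (A B : Type) [CStarAlgebra A] [CStarAlgebra B] where
  H : Type
  [instNACG : NormedAddCommGroup H]
  [instIPS : InnerProductSpace ℂ H]
  [instComplete : CompleteSpace H]
  [instNontrivial : Nontrivial H]
  π : A →⋆ₐ[ℂ] (H →L[ℂ] H)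
  ρ : B →⋆ₐ[ℂ] (H →L[ℂ] H)
  comm : ∀ a b, π a * ρ b = ρ b * π a

attribute [instance] CommRep.instNACG CommRep.instIPS CommRep.instComplete CommRep.instNontrivial

section CStarTensor

variable {A B : Type} [CStarAlgebra A] [CStarAlgebra B]

/-- The pair is, up to unitary equivalence, of the form `a ↦ π₀(a) ⊗ 1`, `b ↦ 1 ⊗ ρ₀(b)` on the
Hilbert space tensor product `H₁ ⊗ H₂` (the completion of the algebraic tensor product). -/
def CommRep.IsSpatial (P : CommRep A B) : Prop :=
  ∃ (H₁ : Type) (_ : NormedAddCommGroup H₁) (_ : InnerProductSpace ℂ H₁) (_ : CompleteSpace H₁)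
    (H₂ : Type) (_ : NormedAddCommGroup H₂) (_ : InnerProductSpace ℂ H₂) (_ : CompleteSpace H₂)
    (π₀ : A →⋆ₐ[ℂ] (H₁ →L[ℂ] H₁)) (ρ₀ : B →⋆ₐ[ℂ] (H₂ →L[ℂ] H₂))
    (J : H₁ ⊗[ℂ] H₂ →ₗᵢ[ℂ] P.H),
    DenseRange J ∧
    (∀ a ξ η, P.π a (J (ξ ⊗ₜ η)) = J (π₀ a ξ ⊗ₜ η)) ∧
    (∀ b ξ η, P.ρ b (J (ξ ⊗ₜ η)) = J (ξ ⊗ₜ ρ₀ b η))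

/-- The direct sum of a family of representations. -/
def diagHom {C : Type} [CStarAlgebra C] {I : Type*} (H : I → Type*)
    [∀ i, NormedAddCommGroup (H i)] [∀ i, InnerProductSpace ℂ (H i)] [∀ i, CompleteSpace (H i)]
    [∀ i, Nontrivial (H i)] (σ : ∀ i, C →⋆ₐ[ℂ] (H i →L[ℂ] H i)) : C →⋆ₐ[ℂ] DiagOp H where
  toFun c := DiagOp.mk (fun i => σ i c) ‖c‖ fun i => NonUnitalStarAlgHom.norm_apply_le (σ i) c
  map_one' := DiagOp.ext fun i => map_one (σ i)
  map_mul' a b := DiagOp.ext fun i => map_mul (σ i) a b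
  map_zero' := DiagOp.ext fun i => map_zero (σ i)
  map_add' a b := DiagOp.ext fun i => map_add (σ i) a b
  commutes' r := DiagOp.ext fun i => AlgHomClass.commutes (σ i) r
  map_star' a := DiagOp.ext fun i => map_star (σ i) a

/-- The completion of `A ⊗ B` in the norm `sup ‖∑ π(a_k) ρ(b_k)‖` over the pairs `(π, ρ)` that
satisfy `𝓕`, realised as the C*-algebra generated by the images of `A` and `B` under the direct sum
of these pairs (the images commute, so that this is the closure of the image of `A ⊗ B`). -/
abbrev tensorCompletion (A B : Type) [CStarAlgebra A] [CStarAlgebra B] (𝓕 : CommRep A B → Prop) :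
    StarSubalgebra ℂ (DiagOp (fun P : {P : CommRep A B // 𝓕 P} => P.1.H)) :=
  cstarGen (Set.range (diagHom (fun P : {P : CommRep A B // 𝓕 P} => P.1.H) fun P => P.1.π) ∪
    Set.range (diagHom (fun P : {P : CommRep A B // 𝓕 P} => P.1.H) fun P => P.1.ρ))

/-- The image of the elementary tensor `a ⊗ b`. -/
def tensorCompletion.tmul (𝓕 : CommRep A B → Prop) (a : A) (b : B) : tensorCompletion A B 𝓕 :=
  ⟨diagHom (fun P : {P : CommRep A B // 𝓕 P} => P.1.H) (fun P => P.1.π) a,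
    subset_cstarGen _ (Or.inl ⟨a, rfl⟩)⟩ *
  ⟨diagHom (fun P : {P : CommRep A B // 𝓕 P} => P.1.H) (fun P => P.1.ρ) b,
    subset_cstarGen _ (Or.inr ⟨b, rfl⟩)⟩

end CStarTensor

/-- The maximal tensor product of C*-algebras. -/
abbrev MaxTensor (A B : Type) [CStarAlgebra A] [CStarAlgebra B] :
    StarSubalgebra ℂ (DiagOp (fun P : {_P : CommRep A B // True} => P.1.H)) :=
  tensorCompletion A B fun _ => True

/-- The minimal (spatial) tensor product of C*-algebras. -/
abbrev MinTensor (A B : Type) [CStarAlgebra A] [CStarAlgebra B] :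
    StarSubalgebra ℂ (DiagOp (fun P : {P : CommRep A B // P.IsSpatial} => P.1.H)) :=
  tensorCompletion A B CommRep.IsSpatial

/-- For a functional `s` on a completion of `B_G ⊗ B_K`, the function
`p^s(x, y) = s(g_{x,x} ⊗ g_{y,y})`. -/
def pStateB (G : Scenario V) (K : Scenario W) {𝓕 : CommRep G.BG K.BG → Prop}
    (s : tensorCompletion G.BG K.BG 𝓕 →ₗ[ℂ] ℂ) : V × W → ℂ :=
  fun z => s (tensorCompletion.tmul 𝓕 (G.bgen z.1) (K.bgen z.2))

/-! ### Affine isomorphisms -/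

/-- A real-valued function, regarded as a complex-valued one. -/
def toComplex (p : V × W → ℝ) : V × W → ℂ := fun z => (p z : ℂ)

/-- `Φ` restricts to an affine isomorphism between the convex sets `C` and `D`. -/
def IsAffineIso {X Y : Type*} [AddCommGroup X] [Module ℝ X] [AddCommGroup Y] [Module ℝ Y]
    (Φ : X → Y) (C : Set X) (D : Set Y) : Prop :=
  Convex ℝ C ∧ Convex ℝ D ∧ Set.BijOn Φ C D ∧
    ∀ s ∈ C, ∀ t ∈ C, ∀ r ∈ Set.Icc (0 : ℝ) 1,
      Φ (r • s + (1 - r) • t) = r • Φ s + (1 - r) • Φ t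

end Contextuality

end

noncomputable section

namespace Contextuality

/-! ### States of C*-algebras -/

section States

universe u

/-! Both cases are proved along the cycle from models to states of the C*-tensor product, from there
to states of the operator system tensor product, and back to models. The link is a dictionary:
unital completely positive maps on `S_G` are exactly the PORs of `G` (`IsPOR.isUCP_map`,
`MatrixOrder.IsUCP.isPOR`). A POR kills the kernel `J̃` because each unit vector turns it into a
probabilistic model and a complex operator with zero quadratic form is zero (`IsPOR.kernel_le`).

From models to C*-states: a commuting model lives on a separable invariant subspace, and square
roots of the POR elements form a ternary representation on some `ℓ²(D)`. The corresponding
coordinate of the universal direct sum sends `g_{x,x}` to `A_x` (`IsPOR.exists_rep`), and the given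
vector defines a state. In the minimal case this handles `Q̃_q`; its closure follows because the
values of states on a fixed family form a closed set (`isClosed_state_values`).

From C*-states to operator system states: the map `a_x ⊗ b_y ↦ g_{x,x} ⊗ h_{y,y}` sends the positive
cone into elements that are positive in every defining representation, hence of the form `c* c`
(`exists_state_of_tensorCompletion`). For spatial representations, vectors of the algebraic tensor
product lie in finite dimensional pieces, and compressing to these reduces to matrix valued maps
(`inner_opTensor_nonneg`).

From operator system states to models: the set of models is closed and convex. If `p^s` lay outside,
a separating affine functional would give an element that all the test maps make positive but on
which `s` is negative (`exists_mem_of_state`). For commuting models closedness and convexity come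
from writing them as the state values of one C*-algebra; for tensor models convexity comes from
direct sums of realisations.

The affine isomorphisms need in addition only that the tensors `a_x ⊗ b_y` span, so that `s ↦ p^s`
is injective. -/

/-- The Gelfand-Naimark-Segal representation of a state, with its cyclic vector. -/
theorem exists_gns {A : Type u} [CStarAlgebra A] {s : A →ₗ[ℂ] ℂ} (hs : s ∈ cstarStates A) :
    ∃ (H : Type u) (_ : NormedAddCommGroup H) (_ : InnerProductSpace ℂ H) (_ : CompleteSpace H)
      (π : A →⋆ₐ[ℂ] (H →L[ℂ] H)) (ξ : H), ‖ξ‖ = 1 ∧ ∀ a, s a = inner ℂ ξ (π a ξ) := by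
  let _ : PartialOrder A := CStarAlgebra.spectralOrder A
  have _ : StarOrderedRing A := CStarAlgebra.spectralOrderedRing A
  let f : A →ₚ[ℂ] ℂ := PositiveLinearMap.mk₀ s fun a ha => by
    obtain ⟨c, rfl⟩ := CStarAlgebra.nonneg_iff_eq_star_mul_self.1 ha
    exact hs.2 c
  have key : ∀ a, s a = inner ℂ ((f.toPreGNS 1 : f.PreGNS) : f.GNS)
      (f.gnsStarAlgHom a (f.toPreGNS 1 : f.PreGNS)) := by
    intro a
    change _ = inner ℂ _ (f.gnsNonUnitalStarAlgHom a (f.toPreGNS 1 : f.PreGNS))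
    rw [PositiveLinearMap.gnsNonUnitalStarAlgHom_apply_coe, UniformSpace.Completion.inner_coe,
      PositiveLinearMap.preGNS_inner_def]
    simp [f]
    rfl
  refine ⟨f.GNS, inferInstance, inferInstance, inferInstance, f.gnsStarAlgHom,
    ((f.toPreGNS 1 : f.PreGNS) : f.GNS), ?_, key⟩
  have h := key 1
  rw [hs.1, map_one f.gnsStarAlgHom, one_apply_eq_self] at h
  rw [@norm_eq_sqrt_re_inner ℂ, ← h]
  simp

theorem norm_state_apply_le {A : Type u} [CStarAlgebra A] {s : A →ₗ[ℂ] ℂ}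
    (hs : s ∈ cstarStates A) (a : A) : ‖s a‖ ≤ ‖a‖ := by
  obtain ⟨H, _, _, _, π, ξ, hξ, h⟩ := exists_gns hs
  rw [h]
  refine (norm_inner_le_norm _ _).trans ?_
  rw [hξ, one_mul]
  refine ((π a).le_opNorm ξ).trans ?_
  rw [hξ, mul_one]
  exact NonUnitalStarAlgHom.norm_apply_le π a

theorem convex_cstarStates (A : Type u) [CStarAlgebra A] : Convex ℝ (cstarStates A) := by
  intro s hs t ht α β hα hβ hab
  refine ⟨?_, fun a => ?_⟩
  · simp only [LinearMap.add_apply, LinearMap.smul_apply, hs.1, ht.1]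
    simpa using (by exact_mod_cast hab : (α : ℂ) + β = 1)
  · simp only [LinearMap.add_apply, LinearMap.smul_apply, Complex.real_smul]
    have hα' : (0 : ℂ) ≤ α := by exact_mod_cast hα
    have hβ' : (0 : ℂ) ≤ β := by exact_mod_cast hβ
    exact add_nonneg (mul_nonneg hα' (hs.2 a)) (mul_nonneg hβ' (ht.2 a))

/-- The values that the states take on a family of elements form a closed set. -/
theorem isClosed_state_values {A : Type u} [CStarAlgebra A] {ι : Type*} (a : ι → A) :
    IsClosed {z : ι → ℂ | ∃ s ∈ cstarStates A, ∀ i, z i = s (a i)} := by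
  rw [isClosed_iff_ultrafilter]
  intro z 𝒰 hz hmem
  -- One state is selected for each tuple of values, with `0` as a dummy off the set, so that the
  -- limits of all `S w b` can be taken along the same ultrafilter.
  have : ∀ w : ι → ℂ, ∃ s : A →ₗ[ℂ] ℂ,
      (∃ s ∈ cstarStates A, ∀ i, w i = s (a i)) → s ∈ cstarStates A ∧ ∀ i, w i = s (a i) := by
    intro w
    by_cases h : ∃ s ∈ cstarStates A, ∀ i, w i = s (a i)
    · obtain ⟨s, hs⟩ := h
      exact ⟨s, fun _ => hs⟩
    · exact ⟨0, fun h' => absurd h' h⟩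
  choose S hS using this
  have hst : ∀ᶠ w in (𝒰 : Filter (ι → ℂ)), S w ∈ cstarStates A ∧ ∀ i, w i = S w (a i) :=
    Filter.mem_of_superset hmem fun w hw => hS w hw
  have hlim : ∀ b : A, ∃ l : ℂ, Filter.Tendsto (fun w => S w b) 𝒰 (nhds l) := by
    intro b
    -- States are contractive, so the values at `b` stay in a compact disc and converge along the
    -- ultrafilter.
    have hb : ∀ᶠ w in (𝒰 : Filter (ι → ℂ)), S w b ∈ Metric.closedBall (0 : ℂ) ‖b‖ := by
      filter_upwards [hst] with w hw
      simpa using norm_state_apply_le hw.1 b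
    obtain ⟨l, -, hl⟩ := (isCompact_closedBall (0 : ℂ) ‖b‖).ultrafilter_le_nhds
      (𝒰.map fun w => S w b) (Filter.le_principal_iff.2 hb)
    exact ⟨l, hl⟩
  choose L hL using hlim
  let s : A →ₗ[ℂ] ℂ :=
    { toFun := L
      map_add' := fun b c => tendsto_nhds_unique (hL (b + c)) <| by
        simpa only [map_add] using (hL b).add (hL c)
      map_smul' := fun r b => tendsto_nhds_unique (hL (r • b)) <| by
        simpa only [map_smul, RingHom.id_apply] using (hL b).const_smul r }
  refine ⟨s, ⟨?_, fun b => ?_⟩, fun i => ?_⟩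
  · refine tendsto_nhds_unique (hL 1) (tendsto_const_nhds.congr' ?_)
    filter_upwards [hst] with w hw using hw.1.1.symm
  · refine ge_of_tendsto (hL (star b * b)) ?_
    filter_upwards [hst] with w hw using hw.1.2 b
  · have h1 : Filter.Tendsto (fun w : ι → ℂ => w i) 𝒰 (nhds (z i)) :=
      ((continuous_apply i).tendsto z).comp hz
    refine tendsto_nhds_unique (h1.congr' ?_) (hL (a i))
    filter_upwards [hst] with w hw using hw.2 i

/-- A positive element of a C*-algebra that lies in a C*-subalgebra is positive there. -/
theorem exists_eq_star_mul_self_of_coe {A : Type u} [CStarAlgebra A] {X : Set A} (x : cstarGen X)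
    (c : A) (hc : (x : A) = star c * c) : ∃ y : cstarGen X, x = star y * y := by
  let _ : PartialOrder A := CStarAlgebra.spectralOrder A
  have _ : StarOrderedRing A := CStarAlgebra.spectralOrderedRing A
  let _ : PartialOrder (cstarGen X) := CStarAlgebra.spectralOrder _
  have _ : StarOrderedRing (cstarGen X) := CStarAlgebra.spectralOrderedRing _
  have h0 : (0 : A) ≤ x := hc ▸ star_mul_self_nonneg c
  have hsa : IsSelfAdjoint x := Subtype.ext (IsSelfAdjoint.of_nonneg h0)
  refine CStarAlgebra.nonneg_iff_eq_star_mul_self.1 ?_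
  -- Positivity of a self-adjoint element depends only on its spectrum, which is the same in a
  -- closed unital star subalgebra. This invariance is used over `ℂ`, so the real spectrum is
  -- transferred there.
  rw [StarOrderedRing.nonneg_iff_spectrum_nonneg (R := ℝ) _] at h0 ⊢
  intro r hr
  refine h0 r ?_
  rw [← spectrum.algebraMap_mem_iff ℂ] at hr ⊢
  exact (StarSubalgebra.mem_spectrum_iff (cstarGen X)).1 hr

end States

/-! ### Diagonal operators -/

section DiagOp

variable {I : Type*} {H : I → Type*} [∀ i, NormedAddCommGroup (H i)]
  [∀ i, InnerProductSpace ℂ (H i)] [∀ i, CompleteSpace (H i)] [∀ i, Nontrivial (H i)]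

/-- The projection of the algebra of diagonal operators onto a component. -/
def DiagOp.eval (i : I) : DiagOp H →⋆ₐ[ℂ] (H i →L[ℂ] H i) where
  toFun T := T.apply i
  map_one' := rfl
  map_mul' _ _ := rfl
  map_zero' := rfl
  map_add' _ _ := rfl
  commutes' _ := rfl
  map_star' _ := rfl

@[simp] theorem DiagOp.eval_apply (i : I) (T : DiagOp H) : DiagOp.eval i T = T.apply i := rfl

theorem DiagOp.norm_apply_le (T : DiagOp H) (i : I) : ‖T.apply i‖ ≤ ‖T‖ :=
  NonUnitalStarAlgHom.norm_apply_le (DiagOp.eval i) T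

theorem exists_eq_adjoint_mul_self {E : Type*} [NormedAddCommGroup E] [InnerProductSpace ℂ E]
    [CompleteSpace E] {T : E →L[ℂ] E} (hT : T.IsPositive) : ∃ R : E →L[ℂ] E, T = star R * R :=
  CStarAlgebra.nonneg_iff_eq_star_mul_self.1 ((ContinuousLinearMap.nonneg_iff_isPositive T).2 hT)

/-- Factors may be chosen in each component separately: the C*-identity gives `‖R i‖² = ‖T i‖ ≤
‖T‖`, so they form a bounded family. -/
theorem DiagOp.exists_eq_star_mul_self (T : DiagOp H) (hT : ∀ i, (T.apply i).IsPositive) :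
    ∃ R : DiagOp H, T = star R * R := by
  choose R hR using fun i => exists_eq_adjoint_mul_self (hT i)
  have hb : ∀ i, ‖R i‖ ≤ Real.sqrt ‖T‖ := by
    intro i
    refine Real.le_sqrt_of_sq_le ?_
    rw [sq, ← CStarRing.norm_star_mul_self, ← hR]
    exact T.norm_apply_le i
  exact ⟨DiagOp.mk R _ hb, DiagOp.ext fun i => hR i⟩

/-- The vector functional of a vector of the Hilbert space with index `i`. -/
def DiagOp.vectorState (i : I) (ξ : H i) : DiagOp H →ₗ[ℂ] ℂ where
  toFun T := inner ℂ ξ (T.apply i ξ)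
  map_add' S T := inner_add_right ξ (S.apply i ξ) (T.apply i ξ)
  map_smul' c T := inner_smul_right ξ (T.apply i ξ) c

theorem DiagOp.vectorState_mem (i : I) (ξ : H i) (hξ : ‖ξ‖ = 1) :
    DiagOp.vectorState i ξ ∈ cstarStates (DiagOp H) := by
  refine ⟨?_, fun T => ?_⟩
  · change inner ℂ ξ ξ = 1
    rw [inner_self_eq_norm_sq_to_K, hξ]; simp
  · change 0 ≤ inner ℂ ξ (ContinuousLinearMap.adjoint (T.apply i) (T.apply i ξ))
    rw [ContinuousLinearMap.adjoint_inner_right]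
    rw [inner_self_eq_norm_sq_to_K]
    positivity

end DiagOp

/-- The restriction of a state to a C*-subalgebra is a state. -/
theorem restrict_mem_cstarStates {A : Type*} [CStarAlgebra A] {X : Set A} {s : A →ₗ[ℂ] ℂ}
    (hs : s ∈ cstarStates A) :
    s ∘ₗ (cstarGen X).subtype.toAlgHom.toLinearMap ∈ cstarStates (cstarGen X) :=
  ⟨hs.1, fun a => hs.2 a⟩

/-! ### Positive operator representations and completely positive maps of `S_G` -/

section Lift

variable {V W : Type}

theorem Scenario.card_ne_zero (G : Scenario V) : (G.edges.card : ℂ) ≠ 0 :=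
  Nat.cast_ne_zero.2 G.nonempty.card_pos.ne'

/-- The pairing of `⊕_e ℓ^∞_e` with a family indexed by the vertices. -/
def Scenario.pairing (G : Scenario V) {F : Type*} [AddCommGroup F] [Module ℂ F] (a : V → F) :
    G.LInfSum →ₗ[ℂ] F where
  -- The factor `|E|⁻¹` cancels the `|E|` in the generators and makes the map unital when `a` sums
  -- to the identity over each hyperedge.
  toFun u := (G.edges.card : ℂ)⁻¹ • ∑ e : G.edges, ∑ x : e.1, u e x • a x
  map_add' u v := by simp only [Pi.add_apply, add_smul, Finset.sum_add_distrib, smul_add]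
  map_smul' c u := by
    simp only [Pi.smul_apply, smul_assoc, ← Finset.smul_sum, RingHom.id_apply]
    rw [smul_comm]

theorem Scenario.pairing_apply (G : Scenario V) {F : Type*} [AddCommGroup F] [Module ℂ F]
    (a : V → F) (u : G.LInfSum) :
    G.pairing a u = (G.edges.card : ℂ)⁻¹ • ∑ e : G.edges, ∑ x : e.1, u e x • a x := rfl

theorem Scenario.pairing_single [DecidableEq V] (G : Scenario V) {F : Type*} [AddCommGroup F]
    [Module ℂ F] (a : V → F) (e : G.edges) (x : e.1) :
    G.pairing a (Pi.single e (Pi.single x 1)) = (G.edges.card : ℂ)⁻¹ • a x := by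
  rw [Scenario.pairing_apply, Finset.sum_eq_single e]
  · simp [Pi.single_apply]
  · intro e' _ hne
    simp [Pi.single_eq_of_ne hne]
  · simp

/-- A family `a` for which the pairing vanishes on `J̃` defines a linear map on `S_G`. -/
def Scenario.lift (G : Scenario V) {F : Type*} [AddCommGroup F] [Module ℂ F] (a : V → F)
    (h : G.kernel ≤ LinearMap.ker (G.pairing a)) : G.SG →ₗ[ℂ] F :=
  G.kernel.liftQ (G.pairing a) h

theorem Scenario.lift_mkQ (G : Scenario V) {F : Type*} [AddCommGroup F] [Module ℂ F] (a : V → F)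
    (h : G.kernel ≤ LinearMap.ker (G.pairing a)) (u : G.LInfSum) :
    G.lift a h (G.kernel.mkQ u) = G.pairing a u := rfl

theorem Scenario.lift_genOf (G : Scenario V) {F : Type*} [AddCommGroup F] [Module ℂ F] (a : V → F)
    (h : G.kernel ≤ LinearMap.ker (G.pairing a)) (e : G.edges) (x : e.1) :
    G.lift a h (G.genOf e x) = a x := by
  classical
  have : G.genOf e x = (G.edges.card : ℂ) • G.kernel.mkQ (Pi.single e (Pi.single x 1)) := by
    unfold Scenario.genOf
    congr!
  rw [this, map_smul, Scenario.lift_mkQ, Scenario.pairing_single, smul_smul,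
    mul_inv_cancel₀ G.card_ne_zero, one_smul]

@[simp] theorem Scenario.lift_gen (G : Scenario V) {F : Type*} [AddCommGroup F] [Module ℂ F]
    (a : V → F) (h : G.kernel ≤ LinearMap.ker (G.pairing a)) (x : V) :
    G.lift a h (G.gen x) = a x :=
  G.lift_genOf a h _ _

theorem Scenario.gen_eq_genOf (G : Scenario V) (e : G.edges) (x : e.1) :
    G.gen x = G.genOf e x :=
  G.genOf_eq _ _ _ _ _

theorem Scenario.gen_eq_smul_single [DecidableEq V] (G : Scenario V) (e : G.edges) (x : e.1) :
    G.gen x = (G.edges.card : ℂ) • G.kernel.mkQ (Pi.single e (Pi.single x 1)) := by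
  rw [G.gen_eq_genOf]
  unfold Scenario.genOf
  congr!

theorem Scenario.mkQ_eq_sum_gen (G : Scenario V) (u : G.LInfSum) :
    G.kernel.mkQ u = (G.edges.card : ℂ)⁻¹ • ∑ e : G.edges, ∑ x : e.1, u e x • G.gen x := by
  classical
  have hu : u = ∑ e : G.edges, ∑ x : e.1, u e x • Pi.single e (Pi.single x 1) := by
    funext e x
    simp only [Finset.sum_apply, Pi.smul_apply]
    rw [Finset.sum_eq_single e]
    · simp [Pi.single_apply]
    · intro e' _ hne
      simp [Pi.single_eq_of_ne hne.symm]
    · simp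
  conv_lhs => rw [hu]
  simp only [G.gen_eq_smul_single, map_sum, map_smul, Finset.smul_sum]
  refine Finset.sum_congr rfl fun e _ => Finset.sum_congr rfl fun x _ => ?_
  rw [smul_comm (u e x), smul_smul, inv_mul_cancel₀ G.card_ne_zero, one_smul]

theorem Scenario.span_gen (G : Scenario V) : Submodule.span ℂ (Set.range G.gen) = ⊤ := by
  refine eq_top_iff.2 fun a _ => ?_
  obtain ⟨u, rfl⟩ := G.kernel.mkQ_surjective a
  rw [G.mkQ_eq_sum_gen]
  exact Submodule.smul_mem _ _ (Submodule.sum_mem _ fun e _ => Submodule.sum_mem _ fun x _ =>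
    Submodule.smul_mem _ _ (Submodule.subset_span ⟨_, rfl⟩))

/-- Both sides pair to `|E|` with every model: the left one has weight `|E|` on the single hyperedge
`e`, the right one has weight `1` on each of the `|E|` hyperedges. Their difference therefore lies
in `J̃`, although it does not vanish edge by edge. -/
theorem Scenario.sum_gen (G : Scenario V) {e : Finset V} (he : e ∈ G.edges) :
    ∑ x ∈ e, G.gen x = G.sgOrder.one := by
  classical
  rw [← Finset.sum_coe_sort]
  rw [Finset.sum_congr rfl fun x _ => G.gen_eq_smul_single ⟨e, he⟩ x]
  rw [← Finset.smul_sum, ← map_sum, ← map_smul]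
  refine (Submodule.Quotient.eq _).2 ?_
  intro p hp
  have h1 : ∀ e' : G.edges, ∑ x : e'.1, (p x : ℂ) = 1 := by
    intro e'
    rw [Finset.sum_coe_sort e'.1 (fun x => (p x : ℂ))]
    exact_mod_cast hp.2 e'.1 e'.2
  have h2 : ∀ e' : G.edges, ∑ y : e'.1, (p y : ℂ) * (((G.edges.card : ℂ) •
      ∑ x : e, Pi.single (M := fun e : G.edges => e.1 → ℂ) ⟨e, he⟩ (Pi.single x 1)) - 1) e' y =
      (if e' = ⟨e, he⟩ then (G.edges.card : ℂ) else 0) - 1 := by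
    intro e'
    split_ifs with h
    · subst h
      simp only [Pi.sub_apply, Pi.smul_apply, Finset.sum_apply, Pi.single_eq_same, Pi.one_apply,
        mul_sub, mul_one, Finset.sum_sub_distrib, h1 ⟨e, he⟩, Pi.single_apply, smul_eq_mul]
      simp only [Finset.sum_ite_eq, Finset.mem_univ, if_true, mul_one]
      rw [← Finset.sum_mul, h1 ⟨e, he⟩, one_mul]
    · simp only [Pi.sub_apply, Pi.smul_apply, Finset.sum_apply, Pi.single_eq_of_ne h, Pi.one_apply,
        mul_sub, mul_one, Finset.sum_sub_distrib, h1 e', Pi.zero_apply, Finset.sum_const_zero,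
        smul_zero, mul_zero]
  refine (Finset.sum_congr rfl fun e' _ => h2 e').trans ?_
  simp

theorem tensor_ext (G : Scenario V) (K : Scenario W) {F : Type*} [AddCommGroup F] [Module ℂ F]
    {f g : G.SG ⊗[ℂ] K.SG →ₗ[ℂ] F} (h : ∀ x y, f (G.gen x ⊗ₜ K.gen y) = g (G.gen x ⊗ₜ K.gen y)) :
    f = g := by
  refine TensorProduct.ext (LinearMap.ext_on_range G.span_gen fun x =>
    LinearMap.ext_on_range K.span_gen fun y => ?_)
  exact h x y

end Lift

/-! ### PORs correspond to unital completely positive maps of `S_G` -/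

section POR

variable {V : Type} {H : Type} [NormedAddCommGroup H] [InnerProductSpace ℂ H] {G : Scenario V}
  {A : V → H →L[ℂ] H}

/-- The distribution of a POR in a unit vector is a probabilistic model. -/
theorem IsPOR.model_mem (hA : IsPOR G A) {ξ : H} (hξ : ‖ξ‖ = 1) :
    (fun x => (inner ℂ ξ (A x ξ)).re) ∈ G.models := by
  have hpos : ∀ x, 0 ≤ (inner ℂ ξ (A x ξ)).re := fun x =>
    (Complex.le_def.1 ((hA.1 x).inner_nonneg_right ξ)).1
  have hsum : ∀ e ∈ G.edges, ∑ x ∈ e, (inner ℂ ξ (A x ξ)).re = 1 := by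
    intro e he
    have h := congrArg (fun T : H →L[ℂ] H => (inner ℂ ξ (T ξ)).re) (hA.2 e he)
    simp only [sum_apply, inner_sum, Complex.re_sum, one_apply_eq_self] at h
    rw [h, inner_self_eq_norm_sq_to_K, hξ]
    simp
  refine ⟨fun x => ⟨hpos x, ?_⟩, hsum⟩
  obtain ⟨e, he, hx⟩ := G.covers x
  rw [← hsum e he]
  exact Finset.single_le_sum (f := fun x => (inner ℂ ξ (A x ξ)).re) (fun y _ => hpos y) hx

theorem IsPOR.inner_eq_re (hA : IsPOR G A) (ξ : H) (x : V) :
    inner ℂ ξ (A x ξ) = ((inner ℂ ξ (A x ξ)).re : ℂ) :=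
  Complex.ext rfl (by simpa using (Complex.le_def.1 ((hA.1 x).inner_nonneg_right ξ)).2.symm)

/-- For a unit vector `ξ` the numbers `⟨A_x ξ, ξ⟩` form a probabilistic model, so an element of `J̃`
is sent to an operator whose quadratic form vanishes. Over `ℂ` such an operator is zero. -/
theorem IsPOR.kernel_le (hA : IsPOR G A) : G.kernel ≤ LinearMap.ker (G.pairing A) := by
  intro u hu
  rw [LinearMap.mem_ker]
  set T := G.pairing A u with hT
  have hunit : ∀ ξ : H, ‖ξ‖ = 1 → inner ℂ ξ (T ξ) = 0 := by
    intro ξ hξ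
    have := hu _ (hA.model_mem hξ)
    simp only [← hA.inner_eq_re] at this
    rw [hT, Scenario.pairing_apply]
    simp only [smul_apply, sum_apply, inner_smul_right, inner_sum]
    simp only [mul_comm (u _ _)]
    rw [this, mul_zero]
  have hall : ∀ ξ : H, inner ℂ (T ξ) ξ = 0 := by
    intro ξ
    rcases eq_or_ne ξ 0 with rfl | h0
    · simp
    have h := hunit ((‖ξ‖⁻¹ : ℂ) • ξ) (by
      rw [norm_smul]; simp [h0])
    rw [map_smul, inner_smul_left, inner_smul_right] at h
    have hn : (‖ξ‖⁻¹ : ℂ) ≠ 0 := by simp [h0]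
    have h' : inner ℂ ξ (T ξ) = 0 := by
      rcases mul_eq_zero.1 h with h | h
      · exact absurd ((map_eq_zero _).1 h) hn
      · exact (mul_eq_zero.1 h).resolve_left hn
    rw [← inner_conj_symm, h', map_zero]
  exact ContinuousLinearMap.coe_injective (inner_map_self_eq_zero (T := T.toLinearMap) |>.1 hall)

/-- The linear map on `S_G` given by a POR. -/
def IsPOR.map (hA : IsPOR G A) : G.SG →ₗ[ℂ] H →L[ℂ] H := G.lift A hA.kernel_le

@[simp] theorem IsPOR.map_gen (hA : IsPOR G A) (x : V) : hA.map (G.gen x) = A x :=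
  G.lift_gen A hA.kernel_le x

/-- Writing `M` as a sum of rank one matrices `v_k v_k*` turns the double sum into `∑ ⟨η_k, T η_k⟩`
with `η_k = ∑ conj(v_k i) ξ_i`. -/
theorem sum_inner_posSemidef_nonneg {T : H →L[ℂ] H} (hT : T.IsPositive) {n : ℕ}
    {M : Matrix (Fin n) (Fin n) ℂ} (hM : M.PosSemidef) (ξ : Fin n → H) :
    0 ≤ ∑ i, ∑ j, M i j * inner ℂ (ξ i) (T (ξ j)) := by
  obtain ⟨m, v, rfl⟩ := Matrix.posSemidef_iff_eq_sum_vecMulVec.1 hM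
  have : ∑ i, ∑ j, (∑ k, Matrix.vecMulVec (v k) (star (v k))) i j * inner ℂ (ξ i) (T (ξ j)) =
      ∑ k, inner ℂ (∑ i, star (v k i) • ξ i) (T (∑ i, star (v k i) • ξ i)) := by
    simp only [Matrix.sum_apply, Matrix.vecMulVec_apply, Finset.sum_mul, map_sum, map_smul,
      sum_inner, inner_sum, inner_smul_left, inner_smul_right, Pi.star_apply]
    refine (Finset.sum_congr rfl fun i _ => Finset.sum_comm).trans (Finset.sum_comm.trans ?_)
    refine Finset.sum_congr rfl fun k _ => ?_
    rw [Finset.sum_comm]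
    refine Finset.sum_congr rfl fun j _ => ?_
    rw [Finset.mul_sum]
    refine Finset.sum_congr rfl fun i _ => ?_
    rw [starRingEnd_apply, star_star]
    ring
  rw [this]
  exact Finset.sum_nonneg fun k _ => hT.inner_nonneg_right _

/-- The pairing sends a positive matrix `w` over `⊕ ℓ^∞_e` to an average of terms (positive scalar
matrix) `⊗ A_x`, which are positive. An element of the quotient cone has such a lift only after
adding `ε 1`, so the inequality is obtained with an error `ε ∑ ‖ξ_i‖²` and then `ε → 0`. -/
theorem IsPOR.isUCP_map (hA : IsPOR G A) : G.sgOrder.IsUCP hA.map := by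
  have hone : G.pairing A 1 = 1 := by
    rw [Scenario.pairing_apply]
    have : ∀ e : G.edges, ∑ x : e.1, (1 : G.LInfSum) e x • A x = 1 := by
      intro e
      simp only [Pi.one_apply, one_smul]
      rw [Finset.sum_coe_sort e.1 A, hA.2 e.1 e.2]
    simp only [this]
    rw [Finset.sum_const, Finset.card_univ, Fintype.card_coe, ← Nat.cast_smul_eq_nsmul ℂ, smul_smul,
      inv_mul_cancel₀ G.card_ne_zero, one_smul]
  refine ⟨hone, fun n M hM ξ => ?_⟩
  set c := ∑ i, ∑ j, inner ℂ (ξ i) (M.map hA.map i j (ξ j)) with hc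
  set d : ℂ := ∑ i, inner ℂ (ξ i) (ξ i) with hd
  have hε : ∀ ε : ℝ, 0 < ε → 0 ≤ c + ε * d := by
    intro ε hε
    obtain ⟨u, rfl, hu⟩ := hM ε hε
    set w := u + Matrix.diagonal fun _ => (ε : ℂ) • G.lInfOrder.one with hw
    have h1 : c + ε * d = ∑ i, ∑ j, inner ℂ (ξ i) (G.pairing A (w i j) (ξ j)) := by
      have : ∀ i j, inner ℂ (ξ i) (G.pairing A (w i j) (ξ j)) =
          inner ℂ (ξ i) ((u.map G.kernel.mkQ).map hA.map i j (ξ j)) +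
          if i = j then ε * inner ℂ (ξ i) (ξ i) else 0 := by
        intro i j
        have e1 : w i j = u i j + if i = j then (ε : ℂ) • (1 : G.LInfSum) else 0 := by
          rw [hw, Matrix.add_apply, Matrix.diagonal_apply]; rfl
        have e2 : (u.map G.kernel.mkQ).map hA.map i j = G.pairing A (u i j) := rfl
        rw [e1, e2, map_add, add_apply, inner_add_right]
        split_ifs with h
        · subst h
          rw [map_smul, hone, smul_apply, one_apply_eq_self, inner_smul_right]
        · simp
      simp only [this, Finset.sum_add_distrib]
      simp [hc, hd, Finset.mul_sum]
    rw [h1]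
    have h2 : ∑ i, ∑ j, inner ℂ (ξ i) (G.pairing A (w i j) (ξ j)) =
        (G.edges.card : ℂ)⁻¹ * ∑ e : G.edges, ∑ x : e.1, ∑ i, ∑ j,
          (w.map fun v => v e x) i j * inner ℂ (ξ i) (A x (ξ j)) := by
      simp only [Scenario.pairing_apply, smul_apply, sum_apply, inner_smul_right, inner_sum,
        ← Finset.mul_sum, Matrix.map_apply]
      congr 1
      have h3 : ∀ f : Fin n → Fin n → (e : G.edges) → e.1 → ℂ,
          ∑ i, ∑ j, ∑ e, ∑ x, f i j e x = ∑ e, ∑ x, ∑ i, ∑ j, f i j e x := by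
        intro f
        calc ∑ i, ∑ j, ∑ e, ∑ x, f i j e x = ∑ i, ∑ e, ∑ x, ∑ j, f i j e x :=
              Finset.sum_congr rfl fun i _ => Finset.sum_comm.trans
                (Finset.sum_congr rfl fun e _ => Finset.sum_comm)
          _ = _ := Finset.sum_comm.trans (Finset.sum_congr rfl fun e _ => Finset.sum_comm)
      exact h3 _
    rw [h2]
    refine mul_nonneg (by positivity) (Finset.sum_nonneg fun e _ => Finset.sum_nonneg fun x _ =>
      sum_inner_posSemidef_nonneg (hA.1 x) (hu e x) ξ)
  have ht : Filter.Tendsto (fun ε : ℝ => c + ε * d) (nhdsWithin 0 (Set.Ioi 0)) (nhds c) := by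
    have : Filter.Tendsto (fun ε : ℝ => c + ε * d) (nhds 0) (nhds (c + (0 : ℝ) * d)) := by
      apply Continuous.tendsto; fun_prop
    simpa using this.mono_left nhdsWithin_le_nhds
  refine ge_of_tendsto ht ?_
  filter_upwards [self_mem_nhdsWithin] with ε h using hε ε h

/-- The representative `|E| δ_x^e` is already positive, so the same lift serves every `ε`. -/
theorem Scenario.gen_mem_cone (G : Scenario V) (x : V) :
    (Matrix.of fun _ _ : Fin 1 => G.gen x) ∈ G.sgOrder.cone 1 := by
  classical
  intro ε hε
  obtain ⟨e, he, hx⟩ := G.covers x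
  refine ⟨Matrix.of fun _ _ =>
    (G.edges.card : ℂ) • (Pi.single ⟨e, he⟩ (Pi.single ⟨x, hx⟩ 1)), ?_, fun f y => ?_⟩
  · ext i j
    rw [Matrix.of_apply, G.gen_eq_smul_single ⟨e, he⟩ ⟨x, hx⟩]
    simp
  · have hz : (0 : ℂ) ≤ (Pi.single (M := fun e : G.edges => e.1 → ℂ) ⟨e, he⟩
        (Pi.single ⟨x, hx⟩ 1)) f y := by
      rcases eq_or_ne f ⟨e, he⟩ with rfl | h
      · rw [Pi.single_eq_same, Pi.single_apply]
        split_ifs <;> simp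
      · rw [Pi.single_eq_of_ne h]; rfl
    have hε' : (0 : ℂ) ≤ ε := by exact_mod_cast hε.le
    have : (((Matrix.of fun _ _ => (G.edges.card : ℂ) • (Pi.single
        (M := fun e : G.edges => e.1 → ℂ) ⟨e, he⟩ (Pi.single ⟨x, hx⟩ 1))) +
        Matrix.diagonal fun _ => (ε : ℂ) • G.lInfOrder.one :
          Matrix (Fin 1) (Fin 1) G.LInfSum).map fun v => v f y) =
        Matrix.diagonal fun _ => (G.edges.card : ℂ) * (Pi.single (M := fun e : G.edges => e.1 → ℂ)
          ⟨e, he⟩ (Pi.single ⟨x, hx⟩ 1)) f y + ε := by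
      ext i j
      fin_cases i; fin_cases j
      simp [Scenario.lInfOrder]
    rw [this, Matrix.posSemidef_diagonal_iff]
    intro _
    positivity

theorem isPositive_of_inner_nonneg {T : H →L[ℂ] H} (h : ∀ ξ, 0 ≤ inner ℂ ξ (T ξ)) :
    T.IsPositive := by
  rw [ContinuousLinearMap.isPositive_iff_complex]
  intro ξ
  have h' : 0 ≤ inner ℂ (T ξ) ξ := by
    rw [← inner_conj_symm]
    exact star_nonneg_iff.2 (h ξ)
  rw [Complex.le_def] at h'
  exact ⟨Complex.ext rfl (by simpa using h'.2), h'.1⟩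

/-- Converse to `IsPOR.isUCP_map`; only the `1 × 1` cone and the unit enter. -/
theorem MatrixOrder.IsUCP.isPOR {φ : G.SG →ₗ[ℂ] H →L[ℂ] H} (hφ : G.sgOrder.IsUCP φ) :
    IsPOR G fun x => φ (G.gen x) := by
  refine ⟨fun x => isPositive_of_inner_nonneg fun ξ => ?_,
    fun e he => by rw [← map_sum, G.sum_gen he, hφ.1]⟩
  simpa using hφ.2 1 _ (G.gen_mem_cone x) fun _ => ξ

end POR

/-! ### Commuting models -/

section Models

variable {V W : Type} {G : Scenario V} {K : Scenario W}

theorem mem_noSignalling_of_marginals {p : V × W → ℝ} {q : W → ℝ} {r : V → ℝ} (hp : ∀ z, 0 ≤ p z)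
    (hq : ∀ e ∈ G.edges, ∀ y, ∑ x ∈ e, p (x, y) = q y)
    (hr : ∀ f ∈ K.edges, ∀ x, ∑ y ∈ f, p (x, y) = r x)
    (hq1 : ∀ f ∈ K.edges, ∑ y ∈ f, q y = 1) : p ∈ noSignalling G K := by
  have hsum : ∀ e ∈ G.edges, ∀ f ∈ K.edges, ∑ z ∈ e ×ˢ f, p z = 1 := by
    intro e he f hf
    rw [Finset.sum_product_right, ← hq1 f hf]
    exact Finset.sum_congr rfl fun y _ => hq e he y
  refine ⟨⟨fun z => ⟨hp z, ?_⟩, fun d hd => ?_⟩, fun y e he e' he' => by rw [hq e he, hq e' he'],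
    fun x f hf f' hf' => by rw [hr f hf, hr f' hf']⟩
  · obtain ⟨x, y⟩ := z
    obtain ⟨e, he, hx⟩ := G.covers x
    obtain ⟨f, hf, hy⟩ := K.covers y
    rw [← hsum e he f hf]
    exact Finset.single_le_sum (fun z _ => hp z) (Finset.mk_mem_product hx hy)
  · classical
    obtain ⟨e, he, f, hf, rfl⟩ := Finset.mem_image₂.1 hd
    exact hsum e he f hf

theorem toComplex_injective : Function.Injective (toComplex : (V × W → ℝ) → V × W → ℂ) :=
  fun _ _ h => funext fun z => Complex.ofReal_injective (congrFun h z)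

theorem isPositive_mul_of_commute {H : Type} [NormedAddCommGroup H] [InnerProductSpace ℂ H]
    [CompleteSpace H] {S T : H →L[ℂ] H} (hS : S.IsPositive) (hT : T.IsPositive)
    (h : S * T = T * S) : (S * T).IsPositive := by
  rw [← ContinuousLinearMap.nonneg_iff_isPositive] at *
  exact Commute.mul_nonneg hS hT h

/-- The values of a commuting pair of PORs in a unit vector form a commuting model. -/
theorem exists_mem_genQC {H : Type} [NormedAddCommGroup H] [InnerProductSpace ℂ H]
    [CompleteSpace H] {A : V → H →L[ℂ] H} {B : W → H →L[ℂ] H} (hA : IsPOR G A) (hB : IsPOR K B)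
    (hAB : ∀ x y, A x * B y = B y * A x) {ξ : H} (hξ : ‖ξ‖ = 1) :
    ∃ p ∈ genQC G K, ∀ x y, (p (x, y) : ℂ) = inner ℂ ξ ((A x * B y) ξ) := by
  have hval : ∀ x y, (((inner ℂ ξ ((A x * B y) ξ)).re : ℝ) : ℂ) = inner ℂ ξ ((A x * B y) ξ) := by
    intro x y
    have h := Complex.le_def.1
      ((isPositive_mul_of_commute (hA.1 x) (hB.1 y) (hAB x y)).inner_nonneg_right ξ)
    exact Complex.ext rfl (by simpa using h.2)
  refine ⟨fun z => (inner ℂ ξ ((A z.1 * B z.2) ξ)).re, ⟨?_, H, inferInstance, inferInstance,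
    inferInstance, A, B, ξ, hA, hB, hAB, hξ, hval⟩, hval⟩
  -- Summing one POR over a hyperedge gives the identity, so the marginals are the distributions of
  -- the other POR alone. No-signalling is thus automatic.
  refine mem_noSignalling_of_marginals (q := fun y => (inner ℂ ξ (B y ξ)).re)
    (r := fun x => (inner ℂ ξ (A x ξ)).re) (fun z => ?_) (fun e he y => ?_) (fun f hf x => ?_)
    (fun f hf => (hB.model_mem hξ).2 f hf)
  · exact (Complex.le_def.1
      ((isPositive_mul_of_commute (hA.1 z.1) (hB.1 z.2) (hAB z.1 z.2)).inner_nonneg_right ξ)).1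
  · simp only
    rw [← Complex.re_sum, ← inner_sum, ← sum_apply, ← Finset.sum_mul, hA.2 e he, one_mul]
  · simp only
    rw [← Complex.re_sum, ← inner_sum, ← sum_apply, ← Finset.mul_sum, hB.2 f hf, mul_one]

/-- The GNS representation carries the two families to commuting PORs and the state to a vector
state. -/
theorem exists_mem_genQC_of_state {A : Type} [CStarAlgebra A] {a : V → A} {b : W → A}
    (ha : ∀ x, ∃ c, a x = star c * c) (hb : ∀ y, ∃ c, b y = star c * c)
    (ha1 : ∀ e ∈ G.edges, ∑ x ∈ e, a x = 1) (hb1 : ∀ f ∈ K.edges, ∑ y ∈ f, b y = 1)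
    (hab : ∀ x y, a x * b y = b y * a x) {s : A →ₗ[ℂ] ℂ} (hs : s ∈ cstarStates A) :
    ∃ p ∈ genQC G K, ∀ x y, (p (x, y) : ℂ) = s (a x * b y) := by
  obtain ⟨H, _, _, _, π, ξ, hξ, h⟩ := exists_gns hs
  have hpos : ∀ c : A, (π (star c * c)).IsPositive := by
    intro c
    rw [map_mul, map_star]
    exact ContinuousLinearMap.isPositive_adjoint_comp_self (π c)
  have hA : IsPOR G fun x => π (a x) := by
    refine ⟨fun x => ?_, fun e he => by rw [← map_sum, ha1 e he, map_one]⟩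
    beta_reduce
    obtain ⟨c, hc⟩ := ha x
    rw [hc]
    exact hpos c
  have hB : IsPOR K fun y => π (b y) := by
    refine ⟨fun y => ?_, fun f hf => by rw [← map_sum, hb1 f hf, map_one]⟩
    beta_reduce
    obtain ⟨c, hc⟩ := hb y
    rw [hc]
    exact hpos c
  obtain ⟨p, hp, hval⟩ := exists_mem_genQC hA hB
    (fun x y => by rw [← map_mul, hab, map_mul]) hξ
  exact ⟨p, hp, fun x y => by rw [hval, h, map_mul]⟩

theorem IsPOR.norm_le {H : Type} [NormedAddCommGroup H] [InnerProductSpace ℂ H]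
    [CompleteSpace H] {A : V → H →L[ℂ] H} (hA : IsPOR G A) (x : V) : ‖A x‖ ≤ 1 := by
  obtain ⟨e, he, hx⟩ := G.covers x
  have h0 : ∀ y, 0 ≤ A y := fun y => (ContinuousLinearMap.nonneg_iff_isPositive _).2 (hA.1 y)
  refine (CStarAlgebra.norm_le_norm_of_nonneg_of_le (h0 x) ?_).trans
    (ContinuousLinearMap.norm_id_le (𝕜 := ℂ) (E := H))
  change A x ≤ 1
  rw [← hA.2 e he]
  exact Finset.single_le_sum (fun y _ => h0 y) hx

/-- The commuting models are the values of the states of one C*-algebra on a family of elements. -/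
theorem exists_genQC_eq_state_values (G : Scenario V) (K : Scenario W) :
    ∃ (A : Type) (_ : CStarAlgebra A) (c : V × W → A),
      toComplex '' genQC G K = {z | ∃ s ∈ cstarStates A, ∀ i, z i = s (c i)} := by
  -- One realisation is chosen for each model, and the direct sum is indexed by the set of models
  -- itself. Its vector states give every model; conversely, any state yields a model through GNS.
  have hex : ∀ p : genQC G K, ∃ (H : Type) (_ : NormedAddCommGroup H) (_ : InnerProductSpace ℂ H)
      (_ : CompleteSpace H) (A : V → H →L[ℂ] H) (B : W → H →L[ℂ] H) (ξ : H),
      IsPOR G A ∧ IsPOR K B ∧ (∀ x y, A x * B y = B y * A x) ∧ ‖ξ‖ = 1 ∧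
      ∀ x y, (p.1 (x, y) : ℂ) = inner ℂ ξ ((A x * B y) ξ) := fun p => p.2.2
  choose H i1 i2 i3 A B ξ hA hB hAB hξ hval using hex
  have : ∀ p, Nontrivial (H p) := fun p => ⟨⟨ξ p, 0, fun h => by simpa [h] using hξ p⟩⟩
  let a : V → DiagOp H := fun x => DiagOp.mk (fun p => A p x) 1 fun p => (hA p).norm_le x
  let b : W → DiagOp H := fun y => DiagOp.mk (fun p => B p y) 1 fun p => (hB p).norm_le y
  have ha1 : ∀ e ∈ G.edges, ∑ x ∈ e, a x = 1 := fun e he => DiagOp.ext fun p => by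
    rw [← DiagOp.eval_apply, ← DiagOp.eval_apply, map_sum, map_one]
    exact (hA p).2 e he
  have hb1 : ∀ f ∈ K.edges, ∑ y ∈ f, b y = 1 := fun f hf => DiagOp.ext fun p => by
    rw [← DiagOp.eval_apply, ← DiagOp.eval_apply, map_sum, map_one]
    exact (hB p).2 f hf
  refine ⟨DiagOp H, inferInstance, fun z => a z.1 * b z.2, Set.Subset.antisymm ?_ ?_⟩
  · rintro _ ⟨p, hp, rfl⟩
    exact ⟨DiagOp.vectorState ⟨p, hp⟩ (ξ ⟨p, hp⟩), DiagOp.vectorState_mem _ _ (hξ _),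
      fun z => hval ⟨p, hp⟩ z.1 z.2⟩
  · rintro z ⟨s, hs, hz⟩
    obtain ⟨p, hp, h⟩ := exists_mem_genQC_of_state (G := G) (K := K)
      (fun x => (a x).exists_eq_star_mul_self fun p => (hA p).1 x)
      (fun y => (b y).exists_eq_star_mul_self fun p => (hB p).1 y) ha1 hb1
      (fun x y => DiagOp.ext fun p => hAB p x y) hs
    exact ⟨p, hp, funext fun i => (h i.1 i.2).trans (hz i).symm⟩

theorem convex_toComplex_genQC (G : Scenario V) (K : Scenario W) :
    Convex ℝ (toComplex '' genQC G K) := by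
  obtain ⟨A, _, c, h⟩ := exists_genQC_eq_state_values G K
  rw [h]
  rintro z ⟨s, hs, hz⟩ w ⟨t, ht, hw⟩ α β hα hβ hab
  refine ⟨α • s + β • t, convex_cstarStates A hs ht hα hβ hab, fun i => ?_⟩
  simp [hz, hw]

/-- The inclusion of the real valued functions, as a real linear map. -/
def toComplexL : (V × W → ℝ) →ₗ[ℝ] (V × W → ℂ) where
  toFun := toComplex
  map_add' p q := by ext; simp [toComplex]
  map_smul' c p := by ext; simp [toComplex]

theorem convex_genQC (G : Scenario V) (K : Scenario W) : Convex ℝ (genQC G K) := by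
  have h := (convex_toComplex_genQC G K).linear_preimage (toComplexL : (V × W → ℝ) →ₗ[ℝ] _)
  rwa [show (toComplexL : (V × W → ℝ) → V × W → ℂ) = toComplex from rfl,
    Set.preimage_image_eq _ toComplex_injective] at h

theorem continuous_toComplex : Continuous (toComplex : (V × W → ℝ) → V × W → ℂ) :=
  continuous_pi fun z => Complex.continuous_ofReal.comp (continuous_apply z)

theorem isClosed_genQC (G : Scenario V) (K : Scenario W) : IsClosed (genQC G K) := by
  obtain ⟨A, _, c, h⟩ := exists_genQC_eq_state_values G K
  have h' := (isClosed_state_values c).preimage (continuous_toComplex (V := V) (W := W))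
  rwa [← h, Set.preimage_image_eq _ toComplex_injective] at h'

end Models

/-! ### Separation -/

section Separation

variable {V W : Type} [Fintype V] [Fintype W] {G : Scenario V} {K : Scenario W}

theorem exists_separating_coefficients {ι : Type*} [Fintype ι] {C : Set (ι → ℝ)}
    (hC : Convex ℝ C) (hC' : IsClosed C) {p : ι → ℝ} (hp : p ∉ C) :
    ∃ (c : ι → ℝ) (α : ℝ), (∀ q ∈ C, α ≤ ∑ i, c i * q i) ∧ ∑ i, c i * p i < α := by
  classical
  obtain ⟨f, α, h1, h2⟩ := geometric_hahn_banach_point_closed hC hC' hp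
  have hf : ∀ q, f q = ∑ i, f (Pi.single i 1) * q i := by
    intro q
    have := LinearMap.pi_apply_eq_sum_univ (f : (ι → ℝ) →ₗ[ℝ] ℝ) q
    simp only [ContinuousLinearMap.coe_coe, smul_eq_mul] at this
    rw [this]
    refine Finset.sum_congr rfl fun i _ => ?_
    rw [mul_comm]
    congr 2
    ext j
    simp [Pi.single_apply, eq_comm]
  exact ⟨fun i => f (Pi.single i 1), α, fun q hq => (hf q ▸ (h2 q hq)).le, hf p ▸ h1⟩

/-- If a closed convex set of functions determines positivity in a tensor product of `S_G` and
`S_K`, then it contains the functions of all states. -/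
theorem exists_mem_of_state {O : MatrixOrder (G.SG ⊗[ℂ] K.SG)} {C : Set (V × W → ℝ)}
    (hC : Convex ℝ C) (hC' : IsClosed C)
    (hgen : ∀ x y, (Matrix.of fun _ _ : Fin 1 => G.gen x ⊗ₜ[ℂ] K.gen y) ∈ O.cone 1)
    (hcone : ∀ (c : V × W → ℝ) (α : ℝ), (∀ q ∈ C, α ≤ ∑ i, c i * q i) →
      (Matrix.of fun _ _ : Fin 1 => ∑ z, (c z : ℂ) • (G.gen z.1 ⊗ₜ[ℂ] K.gen z.2) -
        (α : ℂ) • O.one) ∈ O.cone 1)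
    {s : G.SG ⊗[ℂ] K.SG →ₗ[ℂ] ℂ} (hs : s ∈ O.states) :
    ∃ p ∈ C, toComplex p = pState G K s := by
  -- Positivity of the elementary tensors of generators makes the values of `s` real, so separation
  -- can be done over `ℝ`.
  have hreal : toComplex (fun z => (pState G K s z).re) = pState G K s := by
    funext z
    have h := Complex.le_def.1 (hs.2 _ (hgen z.1 z.2))
    exact Complex.ext rfl (by simpa [pState, toComplex] using h.2)
  refine ⟨_, ?_, hreal⟩
  by_contra hp
  -- The affine functional `q ↦ ∑ c q - α` is nonnegative on `C` and negative at `p^s`. The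
  -- corresponding tensor is in the cone, so `s` cannot be negative on it.
  obtain ⟨c, α, h1, h2⟩ := exists_separating_coefficients hC hC' hp
  have h3 := hs.2 _ (hcone c α h1)
  rw [map_sub, map_sum, map_smul, hs.1] at h3
  simp only [map_smul, smul_eq_mul, mul_one] at h3
  have h4 : ∑ z, (c z : ℂ) * s (G.gen z.1 ⊗ₜ[ℂ] K.gen z.2) =
      ((∑ z, c z * (pState G K s z).re : ℝ) : ℂ) := by
    push_cast
    exact Finset.sum_congr rfl fun z _ => congrArg _ (congrFun hreal z).symm
  rw [h4, ← Complex.ofReal_sub, Complex.zero_le_real] at h3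
  linarith

theorem inner_nonneg_of_unit {H : Type*} [NormedAddCommGroup H] [InnerProductSpace ℂ H]
    {T : H →L[ℂ] H} (h : ∀ ξ, ‖ξ‖ = 1 → 0 ≤ inner ℂ ξ (T ξ)) (ξ : H) : 0 ≤ inner ℂ ξ (T ξ) := by
  rcases eq_or_ne ξ 0 with rfl | h0
  · simp
  have h1 := h ((‖ξ‖⁻¹ : ℂ) • ξ) (by rw [norm_smul]; simp [h0])
  have h2 : ξ = (‖ξ‖ : ℂ) • (‖ξ‖⁻¹ : ℂ) • ξ := by
    rw [smul_smul, mul_inv_cancel₀ (by simpa using h0), one_smul]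
  rw [h2, map_smul, inner_smul_left, inner_smul_right, Complex.conj_ofReal]
  positivity

@[simp] theorem opProd_tmul {S T H : Type} [AddCommGroup S] [Module ℂ S] [AddCommGroup T]
    [Module ℂ T] [NormedAddCommGroup H] [InnerProductSpace ℂ H] (φ : S →ₗ[ℂ] H →L[ℂ] H)
    (ψ : T →ₗ[ℂ] H →L[ℂ] H) (a : S) (b : T) : opProd φ ψ (a ⊗ₜ b) = φ a * ψ b := rfl

theorem inner_combination {H : Type*} [NormedAddCommGroup H] [InnerProductSpace ℂ H]
    {T : V × W → H →L[ℂ] H} {q c : V × W → ℝ} {α : ℝ} {ξ : H} (hξ : ‖ξ‖ = 1)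
    (hq : ∀ z, (q z : ℂ) = inner ℂ ξ (T z ξ)) (h : α ≤ ∑ z, c z * q z) :
    0 ≤ inner ℂ ξ ((∑ z, (c z : ℂ) • T z - (α : ℂ) • (1 : H →L[ℂ] H)) ξ) := by
  have : inner ℂ ξ ((∑ z, (c z : ℂ) • T z - (α : ℂ) • (1 : H →L[ℂ] H)) ξ) =
      ((∑ z, c z * q z - α : ℝ) : ℂ) := by
    simp only [sub_apply, sum_apply, smul_apply, one_apply_eq_self, inner_sub_right, inner_sum,
      inner_smul_right, ← hq, inner_self_eq_norm_sq_to_K, hξ]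
    push_cast
    simp
  rw [this, Complex.zero_le_real]
  linarith

/-- The functions of the states of `S_G ⊗_c S_K` are commuting models. -/
theorem exists_mem_genQC_of_commTensor_state {s : G.SG ⊗[ℂ] K.SG →ₗ[ℂ] ℂ}
    (hs : s ∈ (G.sgOrder.commTensor K.sgOrder).states) :
    ∃ p ∈ genQC G K, toComplex p = pState G K s := by
  refine exists_mem_of_state (convex_genQC G K) (isClosed_genQC G K) ?_ ?_ hs
  · intro x y H _ _ _ φ ψ hφ hψ hcomm ξ
    simpa using (isPositive_mul_of_commute (hφ.isPOR.1 x) (hψ.isPOR.1 y)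
      (hcomm _ _)).inner_nonneg_right (ξ 0)
  · intro c α h H _ _ _ φ ψ hφ hψ hcomm ξ
    have key : ∀ η : H, 0 ≤ inner ℂ η
        ((∑ z : V × W, (c z : ℂ) • (φ (G.gen z.1) * ψ (K.gen z.2)) - (α : ℂ) • 1) η) := by
      refine fun η => inner_nonneg_of_unit (fun ξ hξ => ?_) η
      -- Each pair of test maps with a unit vector is itself a commuting model, so the scalar
      -- inequality on models is an operator inequality.
      obtain ⟨q, hq, hval⟩ := exists_mem_genQC hφ.isPOR hψ.isPOR (fun x y => hcomm _ _) hξ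
      exact inner_combination hξ (fun z => hval z.1 z.2) (h q hq)
    have hone : opProd φ ψ (G.sgOrder.commTensor K.sgOrder).one = 1 := by
      change φ _ * ψ _ = 1
      rw [hφ.1, hψ.1, one_mul]
    simpa [hone] using key (ξ 0)

end Separation

/-! ### The universal property of `B_G` -/

section Universal

/-- Distinct orthonormal vectors are at distance `√2 ≥ 1`, so the balls of radius `1/2` around them
are disjoint open sets in a separable space. -/
theorem countable_of_orthonormal {H ι : Type*} [NormedAddCommGroup H] [InnerProductSpace ℂ H]
    [TopologicalSpace.SeparableSpace H] {v : ι → H} (hv : Orthonormal ℂ v) : Countable ι := by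
  have hd : ∀ i j, i ≠ j → 1 ≤ dist (v i) (v j) := by
    intro i j hij
    have h := norm_sub_sq (𝕜 := ℂ) (v i) (v j)
    rw [hv.2 hij, hv.1, hv.1] at h
    rw [dist_eq_norm]
    have : (1 : ℝ) ≤ ‖v i - v j‖ ^ 2 := by rw [h]; norm_num
    nlinarith [norm_nonneg (v i - v j)]
  refine Pairwise.countable_of_isOpen_disjoint (s := fun i => Metric.ball (v i) (1 / 2))
    (fun i j hij => ?_) (fun _ => Metric.isOpen_ball) fun i => ⟨v i, by simp⟩
  exact Metric.ball_disjoint_ball (by linarith [hd i j hij])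

/-- A separable Hilbert space is isomorphic to `ℓ²(D)` for a set `D` of real numbers. -/
theorem exists_linearIsometryEquiv_L2 (H : Type*) [NormedAddCommGroup H] [InnerProductSpace ℂ H]
    [CompleteSpace H] [Nontrivial H] [TopologicalSpace.SeparableSpace H] :
    ∃ D : Set ℝ, D.Nonempty ∧ Nonempty (H ≃ₗᵢ[ℂ] L2 D) := by
  obtain ⟨w, b, hb⟩ := exists_hilbertBasis ℂ H
  have hw : Countable w := countable_of_orthonormal b.orthonormal
  obtain ⟨f, hf⟩ := exists_injective_nat w
  let g : w → ℝ := fun i => (f i : ℝ)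
  have hg : Function.Injective g := fun i j h => hf (Nat.cast_injective h)
  let σ := Equiv.ofInjective g hg
  have horth : Orthonormal ℂ (b ∘ σ.symm) := b.orthonormal.comp _ σ.symm.injective
  have hspan : ⊤ ≤ (Submodule.span ℂ (Set.range (b ∘ σ.symm))).topologicalClosure := by
    rw [σ.symm.surjective.range_comp, b.dense_span]
  let b' : HilbertBasis (Set.range g) ℂ H := HilbertBasis.mk horth hspan
  refine ⟨Set.range g, ?_, ⟨b'.repr⟩⟩
  rw [Set.range_nonempty_iff_nonempty]
  -- An empty basis would make the zero subspace dense, against nontriviality.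
  by_contra hempty
  rw [not_nonempty_iff] at hempty
  have h := b.dense_span
  rw [Set.range_eq_empty, Submodule.span_empty,
    IsClosed.submodule_topologicalClosure_eq (by simp)] at h
  exact bot_ne_top h

variable {V W : Type}

theorem Scenario.TernaryRep.isPOR {G : Scenario V} (θ : G.TernaryRep) :
    IsPOR G fun x => (ContinuousLinearMap.adjoint (θ.U x)) ∘L (θ.U x) :=
  ⟨fun x => ContinuousLinearMap.isPositive_adjoint_comp_self (θ.U x), θ.sum_eq⟩

/-- A POR on a separable Hilbert space defines a representation of the ambient algebra
of `B_G`. -/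
theorem IsPOR.exists_rep {G : Scenario V} {H : Type} [NormedAddCommGroup H]
    [InnerProductSpace ℂ H] [CompleteSpace H] [Nontrivial H] [TopologicalSpace.SeparableSpace H]
    {A : V → H →L[ℂ] H} (hA : IsPOR G A) :
    ∃ π : DiagOp (fun θ : G.TernaryRep => θ.space) →⋆ₐ[ℂ] (H →L[ℂ] H), ∀ x, π (G.g x x) = A x := by
  obtain ⟨D, hD, ⟨Ψ⟩⟩ := exists_linearIsometryEquiv_L2 H
  choose R hR using fun x => exists_eq_adjoint_mul_self (hA.1 x)
  have hU : ∀ x, (ContinuousLinearMap.adjoint (Ψ.conjStarAlgEquiv (R x))) ∘L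
      (Ψ.conjStarAlgEquiv (R x)) = Ψ.conjStarAlgEquiv (A x) := by
    intro x
    change star (Ψ.conjStarAlgEquiv (R x)) * Ψ.conjStarAlgEquiv (R x) = _
    rw [← map_star, ← map_mul, ← hR]
  -- With `A_x = R_x* R_x`, the operators `R_x`, moved to `ℓ²(D)`, satisfy the ternary relations
  -- with equal domain and codomain.
  let θ : G.TernaryRep :=
    { dom := D
      cod := D
      dom_nonempty := hD
      U := fun x => Ψ.conjStarAlgEquiv (R x)
      sum_eq := fun e he => by
        rw [Finset.sum_congr rfl fun x _ => hU x, ← map_sum, hA.2 e he, map_one] }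
  refine ⟨(StarAlgHomClass.toStarAlgHom Ψ.conjStarAlgEquiv.symm).comp
    (DiagOp.eval θ), fun x => ?_⟩
  change Ψ.conjStarAlgEquiv.symm ((ContinuousLinearMap.adjoint (Ψ.conjStarAlgEquiv (R x))) ∘L
      (Ψ.conjStarAlgEquiv (R x))) = A x
  rw [hU, StarAlgEquiv.symm_apply_apply]

/-- If the images of the generators commute with `S = S*`, so do the images of all elements. -/
theorem commute_of_mem_cstarGen {A B : Type*} [CStarAlgebra A] [CStarAlgebra B]
    (σ : A →⋆ₐ[ℂ] B) {X : Set A} {S : Set B} (hS : ∀ t ∈ S, star t ∈ S)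
    (h : ∀ x ∈ X, ∀ t ∈ S, σ x * t = t * σ x) {a : A} (ha : a ∈ cstarGen X) {t : B} (ht : t ∈ S) :
    σ a * t = t * σ a := by
  -- Since `S = S*`, the star centralizer is the ordinary centralizer, which is closed; its preimage
  -- under `σ` is a closed star subalgebra.
  have hcl : IsClosed ((StarSubalgebra.comap σ (StarSubalgebra.centralizer ℂ S)) : Set A) := by
    have : ((StarSubalgebra.comap σ (StarSubalgebra.centralizer ℂ S)) : Set A) =
        σ ⁻¹' (Set.centralizer S) := by
      ext a
      simp only [StarSubalgebra.coe_comap, Set.mem_preimage, SetLike.mem_coe,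
        StarSubalgebra.mem_centralizer_iff, Set.mem_centralizer_iff]
      exact ⟨fun h t ht => (h t ht).1, fun h t ht => ⟨h t ht, h _ (hS t ht)⟩⟩
    rw [this]
    exact (Set.isClosed_centralizer S).preimage
      (AddMonoidHomClass.continuous_of_bound σ 1 fun a => by
        simpa using NonUnitalStarAlgHom.norm_apply_le σ a)
  have hle : cstarGen X ≤ StarSubalgebra.comap σ (StarSubalgebra.centralizer ℂ S) := by
    refine StarSubalgebra.topologicalClosure_minimal (StarAlgebra.adjoin_le fun x hx => ?_) hcl
    simp only [StarSubalgebra.coe_comap, Set.mem_preimage, SetLike.mem_coe,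
      StarSubalgebra.mem_centralizer_iff]
    exact fun t ht => ⟨(h x hx t ht).symm, (h x hx _ (hS t ht)).symm⟩
  have := hle ha
  exact ((StarSubalgebra.mem_centralizer_iff ℂ).1 this t ht).1.symm

/-- Representations for which the images of the generators commute restrict to commuting
representations of the generated algebras. -/
theorem commute_of_generators {A B C : Type*} [CStarAlgebra A] [CStarAlgebra B] [CStarAlgebra C]
    (π : A →⋆ₐ[ℂ] C) (ρ : B →⋆ₐ[ℂ] C) {X : Set A} {Y : Set B}
    (hY : ∀ y ∈ Y, star (ρ y) = ρ y) (h : ∀ x ∈ X, ∀ y ∈ Y, π x * ρ y = ρ y * π x)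
    {a : A} (ha : a ∈ cstarGen X) {b : B} (hb : b ∈ cstarGen Y) : π a * ρ b = ρ b * π a := by
  have h1 : ∀ a ∈ cstarGen X, ∀ t ∈ ρ '' Y, π a * t = t * π a := by
    intro a ha t ht
    refine commute_of_mem_cstarGen π ?_ ?_ ha ht
    · rintro _ ⟨y, hy, rfl⟩
      exact ⟨y, hy, (hY y hy).symm⟩
    · rintro x hx _ ⟨y, hy, rfl⟩
      exact h x hx y hy
  refine (commute_of_mem_cstarGen ρ (S := π '' cstarGen X) ?_ ?_ hb ⟨a, ha, rfl⟩).symm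
  · rintro _ ⟨a, ha, rfl⟩
    exact ⟨star a, star_mem ha, map_star π a⟩
  · rintro y hy _ ⟨a, ha, rfl⟩
    exact (h1 a ha _ ⟨y, hy, rfl⟩).symm

end Universal

/-! ### Components of completed tensor products -/

section Completion

variable {I : Type*} {H : I → Type*} [∀ i, NormedAddCommGroup (H i)]
  [∀ i, InnerProductSpace ℂ (H i)] [∀ i, CompleteSpace (H i)] [∀ i, Nontrivial (H i)]

/-- The projection of an algebra of diagonal operators onto a component. -/
def evalGen (X : Set (DiagOp H)) (i : I) : cstarGen X →⋆ₐ[ℂ] (H i →L[ℂ] H i) :=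
  (DiagOp.eval i).comp (cstarGen X).subtype

theorem evalGen_ext {X : Set (DiagOp H)} {a b : cstarGen X}
    (h : ∀ i, evalGen X i a = evalGen X i b) : a = b :=
  Subtype.ext (DiagOp.ext h)

/-- Componentwise factors give a factor in the ambient algebra of diagonal operators, and positivity
then descends to the generated subalgebra. -/
theorem exists_eq_star_mul_self_of_evalGen {X : Set (DiagOp H)} (a : cstarGen X)
    (h : ∀ i, (evalGen X i a).IsPositive) : ∃ c, a = star c * c := by
  obtain ⟨R, hR⟩ := DiagOp.exists_eq_star_mul_self a.1 h
  exact exists_eq_star_mul_self_of_coe a R hR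

variable {A B : Type} [CStarAlgebra A] [CStarAlgebra B] {𝓕 : CommRep A B → Prop}

theorem evalGen_tmul (P : {P : CommRep A B // 𝓕 P}) (a : A) (b : B) :
    evalGen _ P (tensorCompletion.tmul 𝓕 a b) = P.1.π a * P.1.ρ b := rfl

theorem tensorCompletion.exists_vector_state (P : CommRep A B) (hP : 𝓕 P) {ξ : P.H}
    (hξ : ‖ξ‖ = 1) : ∃ s ∈ cstarStates (tensorCompletion A B 𝓕),
      ∀ a b, s (tensorCompletion.tmul 𝓕 a b) = inner ℂ ξ ((P.π a * P.ρ b) ξ) :=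
  ⟨_, restrict_mem_cstarStates (DiagOp.vectorState_mem
    (H := fun P : {P : CommRep A B // 𝓕 P} => P.1.H) ⟨P, hP⟩ ξ hξ), fun _ _ => rfl⟩

theorem exists_maxTensor_vector_state {H : Type} [NormedAddCommGroup H] [InnerProductSpace ℂ H]
    [CompleteSpace H] [Nontrivial H] (π : A →⋆ₐ[ℂ] (H →L[ℂ] H)) (ρ : B →⋆ₐ[ℂ] (H →L[ℂ] H))
    (hcomm : ∀ a b, π a * ρ b = ρ b * π a) {ξ : H} (hξ : ‖ξ‖ = 1) :
    ∃ s ∈ cstarStates (MaxTensor A B),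
      ∀ a b, s (tensorCompletion.tmul _ a b) = inner ℂ ξ ((π a * ρ b) ξ) :=
  tensorCompletion.exists_vector_state { H := H, π := π, ρ := ρ, comm := hcomm } trivial hξ

/-- The representations are given on the ambient algebras, where their ranges need not commute;
commutation on the generators suffices after restriction. -/
theorem exists_maxTensor_cstarGen_state {𝔄 𝔅 : Type} [CStarAlgebra 𝔄] [CStarAlgebra 𝔅] {X : Set 𝔄}
    {Y : Set 𝔅} {H : Type} [NormedAddCommGroup H] [InnerProductSpace ℂ H]
    [CompleteSpace H] [Nontrivial H] (π : 𝔄 →⋆ₐ[ℂ] (H →L[ℂ] H)) (ρ : 𝔅 →⋆ₐ[ℂ] (H →L[ℂ] H))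
    (hY : ∀ y ∈ Y, star (ρ y) = ρ y) (h : ∀ x ∈ X, ∀ y ∈ Y, π x * ρ y = ρ y * π x)
    {ξ : H} (hξ : ‖ξ‖ = 1) :
    ∃ s ∈ cstarStates (MaxTensor (cstarGen X) (cstarGen Y)),
      ∀ a b, s (tensorCompletion.tmul _ a b) = inner ℂ ξ ((π a * ρ b) ξ) :=
  exists_maxTensor_vector_state (π.comp (cstarGen X).subtype) (ρ.comp (cstarGen Y).subtype)
    (fun a b => commute_of_generators π ρ hY h a.2 b.2) hξ

theorem tensorCompletion.tmul_one_one : tensorCompletion.tmul 𝓕 (1 : A) (1 : B) = 1 :=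
  evalGen_ext fun P => by rw [evalGen_tmul, map_one, map_one, map_one, one_mul]

variable (A B 𝓕) in
/-- The canonical map from `A ⊗ B` to a completion. -/
def tensorCompletion.ofTensor : A ⊗[ℂ] B →ₗ[ℂ] tensorCompletion A B 𝓕 :=
  TensorProduct.lift (LinearMap.mk₂ ℂ (tensorCompletion.tmul 𝓕)
    (fun a a' b => evalGen_ext fun P => by simp only [map_add, evalGen_tmul, add_mul])
    (fun c a b => evalGen_ext fun P => by simp only [map_smul, evalGen_tmul, smul_mul_assoc])
    (fun a b b' => evalGen_ext fun P => by simp only [map_add, evalGen_tmul, mul_add])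
    (fun c a b => evalGen_ext fun P => by simp only [map_smul, evalGen_tmul, mul_smul_comm]))

theorem tensorCompletion.ofTensor_tmul (a : A) (b : B) :
    tensorCompletion.ofTensor A B 𝓕 (a ⊗ₜ b) = tensorCompletion.tmul 𝓕 a b := rfl

theorem evalGen_ofTensor (P : {P : CommRep A B // 𝓕 P}) (t : A ⊗[ℂ] B) :
    evalGen _ P (tensorCompletion.ofTensor A B 𝓕 t) =
      opProd P.1.π.toAlgHom.toLinearMap P.1.ρ.toAlgHom.toLinearMap t := by
  induction t with
  | zero => rw [map_zero, map_zero, map_zero]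
  | add t u ht hu => rw [map_add, map_add, map_add, ht, hu]
  | tmul a b => rfl

end Completion

/-! ### Restriction to a separable subspace -/

section Separable

variable {V W : Type} {H : Type} [NormedAddCommGroup H] [InnerProductSpace ℂ H]

/-- The restriction of an operator to an invariant subspace. -/
def restrictOp (L : Submodule ℂ H) (T : H →L[ℂ] H) (h : ∀ η ∈ L, T η ∈ L) : L →L[ℂ] L :=
  (T ∘L L.subtypeL).codRestrict L fun η => h η η.2

theorem coe_restrictOp (L : Submodule ℂ H) (T : H →L[ℂ] H) (h : ∀ η ∈ L, T η ∈ L) (η : L) :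
    (restrictOp L T h η : H) = T η := rfl

theorem IsPOR.restrict {G : Scenario V} {A : V → H →L[ℂ] H} (hA : IsPOR G A) (L : Submodule ℂ H)
    (h : ∀ x, ∀ η ∈ L, A x η ∈ L) : IsPOR G fun x => restrictOp L (A x) (h x) := by
  refine ⟨fun x => isPositive_of_inner_nonneg fun ξ => (hA.1 x).inner_nonneg_right ξ.1,
    fun e he => ?_⟩
  ext η
  have := congrArg (fun T : H →L[ℂ] H => T η) (hA.2 e he)
  simpa [coe_restrictOp] using this

/-- A countable family of operators leaves a separable closed subspace around a vector
invariant. -/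
theorem exists_separable_invariant {ι : Type*} [Countable ι] (T : ι → H →L[ℂ] H) (ξ : H) :
    ∃ L : Submodule ℂ H, ξ ∈ L ∧ IsClosed (L : Set H) ∧ TopologicalSpace.SeparableSpace L ∧
      ∀ i, ∀ η ∈ L, T i η ∈ L := by
  -- The countably many words in the operators, applied to `ξ`, span the subspace. Applying `T i`
  -- only prepends a letter.
  let w : List ι → H := fun l => (l.map T).prod ξ
  let L := (Submodule.span ℂ (Set.range w)).topologicalClosure
  refine ⟨L, ?_, Submodule.isClosed_topologicalClosure _, ?_, fun i => ?_⟩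
  · exact Submodule.le_topologicalClosure _ (Submodule.subset_span ⟨[], by simp [w]⟩)
  · have : TopologicalSpace.IsSeparable (L : Set H) :=
      ((Set.countable_range w).isSeparable.span (R := ℂ)).closure
    exact this.separableSpace
  · have hle : L ≤ L.comap (T i).toLinearMap := by
      refine Submodule.topologicalClosure_minimal _ (Submodule.span_le.2 ?_)
        ((Submodule.isClosed_topologicalClosure _).preimage (T i).continuous)
      rintro _ ⟨l, rfl⟩
      exact Submodule.le_topologicalClosure _ (Submodule.subset_span ⟨i :: l, by simp [w]⟩)
    exact fun η hη => hle hη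

end Separable

/-! ### States of the maximal tensor product from commuting models -/

section MaxState

variable {V W : Type}

/-- A commuting model can be realised on a separable Hilbert space. -/
theorem exists_separable_realisation [Fintype V] [Fintype W] {G : Scenario V} {K : Scenario W}
    {p : V × W → ℝ} (hp : p ∈ genQC G K) :
    ∃ (H : Type) (_ : NormedAddCommGroup H) (_ : InnerProductSpace ℂ H) (_ : CompleteSpace H)
      (_ : Nontrivial H) (_ : TopologicalSpace.SeparableSpace H)
      (A : V → H →L[ℂ] H) (B : W → H →L[ℂ] H) (ξ : H),
      IsPOR G A ∧ IsPOR K B ∧ (∀ x y, A x * B y = B y * A x) ∧ ‖ξ‖ = 1 ∧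
      ∀ x y, (p (x, y) : ℂ) = inner ℂ ξ ((A x * B y) ξ) := by
  obtain ⟨-, H, _, _, _, A, B, ξ, hA, hB, hAB, hξ, hval⟩ := hp
  obtain ⟨L, hξL, hcl, hsep, hinv⟩ := exists_separable_invariant (Sum.elim A B) ξ
  have hnt : Nontrivial L := ⟨⟨⟨ξ, hξL⟩, 0, fun h => by
    have : ξ = 0 := congrArg Subtype.val h
    simp [this] at hξ⟩⟩
  refine ⟨L, inferInstance, inferInstance, hcl.completeSpace_coe, hnt, hsep, _, _, ⟨ξ, hξL⟩,
    hA.restrict L fun x => hinv (Sum.inl x), hB.restrict L fun y => hinv (Sum.inr y),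
    fun x y => ?_, hξ, hval⟩
  ext η
  exact congrArg (fun T : H →L[ℂ] H => T η) (hAB x y)

/-- The functions of the states of `B_G ⊗_max B_K`. -/
def maxStateFunctions (G : Scenario V) (K : Scenario W) : Set (V × W → ℂ) :=
  {z | ∃ s ∈ cstarStates (MaxTensor G.BG K.BG), z = pStateB G K s}

/-- Commuting models are given by states of the maximal tensor product. -/
theorem toComplex_mem_maxStateFunctions [Fintype V] [Fintype W] {G : Scenario V} {K : Scenario W}
    {p : V × W → ℝ} (hp : p ∈ genQC G K) :
    toComplex p ∈ maxStateFunctions G K := by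
  have hreal := exists_separable_realisation hp
  obtain ⟨H, _, _, _, _, _, A, B, ξ, hA, hB, hAB, hξ, hval⟩ := hreal
  have hrepA := hA.exists_rep
  have hrepB := hB.exists_rep
  obtain ⟨π, hπ⟩ := hrepA
  obtain ⟨ρ, hρ⟩ := hrepB
  have hstate := exists_maxTensor_cstarGen_state π ρ
    (X := Set.range fun x => G.g x x) (Y := Set.range fun y => K.g y y) (ξ := ξ)
    (by
      rintro _ ⟨y, rfl⟩
      rw [hρ]
      exact (hB.1 y).isSelfAdjoint.star_eq)
    (by
      rintro _ ⟨x, rfl⟩ _ ⟨y, rfl⟩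
      rw [hπ, hρ]
      exact hAB x y) hξ
  obtain ⟨s, hs, hval'⟩ := hstate
  refine ⟨s, hs, funext fun z => (hval z.1 z.2).trans ?_⟩
  refine Eq.trans ?_ (hval' (G.bgen z.1) (K.bgen z.2)).symm
  change _ = inner ℂ ξ ((π (G.g z.1 z.1) * ρ (K.g z.2 z.2)) ξ)
  rw [hπ, hρ]

end MaxState

/-! ### Restriction of states to `S_G ⊗ S_K` -/

section Restriction

variable {V W : Type}

theorem Scenario.map_pairing (G : Scenario V) {E F : Type*} [AddCommGroup E] [Module ℂ E]
    [AddCommGroup F] [Module ℂ F] (f : E →ₗ[ℂ] F) (a : V → E) (u : G.LInfSum) :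
    f (G.pairing a u) = G.pairing (fun x => f (a x)) u := by
  simp only [Scenario.pairing_apply, map_smul, map_sum]

/-- A family of positive elements of a C*-algebra with the relations of `S_G`. -/
structure IsAlgebraicPOR (G : Scenario V) {C : Type} [CStarAlgebra C] (a : V → C) : Prop where
  kernel_le : G.kernel ≤ LinearMap.ker (G.pairing a)
  sum_eq : ∀ e ∈ G.edges, ∑ x ∈ e, a x = 1
  eq_star_mul_self : ∀ x, ∃ c, a x = star c * c

/-- All three conditions can be tested in the components; there the relations of `J̃` are supplied
by `IsPOR.kernel_le`. -/
theorem isAlgebraicPOR_of_evalGen {G : Scenario V} {I : Type} {H : I → Type}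
    [∀ i, NormedAddCommGroup (H i)] [∀ i, InnerProductSpace ℂ (H i)] [∀ i, CompleteSpace (H i)]
    [∀ i, Nontrivial (H i)] {X : Set (DiagOp H)} {a : V → cstarGen X}
    (h : ∀ i, IsPOR G fun x => evalGen X i (a x)) :
    IsAlgebraicPOR G a where
  kernel_le u hu := by
    rw [LinearMap.mem_ker]
    refine evalGen_ext fun i => ?_
    rw [map_zero]
    exact (G.map_pairing (evalGen X i).toAlgHom.toLinearMap a u).trans ((h i).kernel_le hu)
  sum_eq e he := evalGen_ext fun i => by
    rw [map_sum, map_one]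
    exact (h i).2 e he
  eq_star_mul_self x := exists_eq_star_mul_self_of_evalGen _ fun i => (h i).1 x

theorem Scenario.isAlgebraicPOR_bgen (G : Scenario V) : IsAlgebraicPOR G G.bgen :=
  isAlgebraicPOR_of_evalGen fun θ => θ.isPOR

section Algebra

variable {G : Scenario V} {K : Scenario W} {A B : Type} [CStarAlgebra A] [CStarAlgebra B]
  {a : V → A} {b : W → B}

/-- The linear map on `S_G` given by elements of a C*-algebra. -/
def IsAlgebraicPOR.map (ha : IsAlgebraicPOR G a) : G.SG →ₗ[ℂ] A := G.lift a ha.kernel_le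

@[simp] theorem IsAlgebraicPOR.map_gen (ha : IsAlgebraicPOR G a) (x : V) :
    ha.map (G.gen x) = a x :=
  G.lift_gen _ _ x

theorem IsAlgebraicPOR.map_one (ha : IsAlgebraicPOR G a) : ha.map G.sgOrder.one = 1 := by
  obtain ⟨e, he⟩ := G.nonempty
  rw [← G.sum_gen he, map_sum]
  simp only [IsAlgebraicPOR.map_gen]
  exact ha.sum_eq e he

theorem IsAlgebraicPOR.isPOR (ha : IsAlgebraicPOR G a) {H : Type} [NormedAddCommGroup H]
    [InnerProductSpace ℂ H] [CompleteSpace H] (π : A →⋆ₐ[ℂ] (H →L[ℂ] H)) :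
    IsPOR G fun x => π (a x) := by
  refine ⟨fun x => ?_, fun e he => by rw [← map_sum, ha.sum_eq e he, _root_.map_one]⟩
  obtain ⟨c, hc⟩ := ha.eq_star_mul_self x
  beta_reduce
  rw [hc, map_mul, map_star]
  exact ContinuousLinearMap.isPositive_adjoint_comp_self (π c)

theorem IsAlgebraicPOR.isPOR_map (ha : IsAlgebraicPOR G a) {H : Type} [NormedAddCommGroup H]
    [InnerProductSpace ℂ H] [CompleteSpace H] (π : A →⋆ₐ[ℂ] (H →L[ℂ] H)) :
    (ha.isPOR π).map = π.toAlgHom.toLinearMap ∘ₗ ha.map :=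
  LinearMap.ext_on_range G.span_gen fun x => by simp

/-- A state of a completion of `A ⊗ B` restricts to a state of `S_G ⊗ S_K`, if the elements
that are positive in `S_G ⊗ S_K` are positive in all representations that define the completion. -/
theorem exists_state_of_tensorCompletion (ha : IsAlgebraicPOR G a) (hb : IsAlgebraicPOR K b)
    {𝓕 : CommRep A B → Prop} {O : MatrixOrder (G.SG ⊗[ℂ] K.SG)}
    (hone : O.one = G.sgOrder.one ⊗ₜ K.sgOrder.one)
    (hpos : ∀ P, 𝓕 P → ∀ t, (Matrix.of fun _ _ : Fin 1 => t) ∈ O.cone 1 →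
      (opProd (ha.isPOR P.π).map (hb.isPOR P.ρ).map t).IsPositive)
    {s : tensorCompletion A B 𝓕 →ₗ[ℂ] ℂ} (hs : s ∈ cstarStates (tensorCompletion A B 𝓕)) :
    ∃ s' ∈ O.states, ∀ x y, s (tensorCompletion.tmul 𝓕 (a x) (b y)) =
      s' (G.gen x ⊗ₜ K.gen y) := by
  refine ⟨s ∘ₗ tensorCompletion.ofTensor A B 𝓕 ∘ₗ TensorProduct.map ha.map hb.map,
    ⟨?_, fun t ht => ?_⟩, fun x y => ?_⟩
  · rw [hone, LinearMap.comp_apply, LinearMap.comp_apply, TensorProduct.map_tmul, ha.map_one,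
      hb.map_one, tensorCompletion.ofTensor_tmul, tensorCompletion.tmul_one_one, hs.1]
  · have h : ∀ P, (evalGen _ P (tensorCompletion.ofTensor A B 𝓕
        (TensorProduct.map ha.map hb.map t))).IsPositive := by
      intro P
      rw [evalGen_ofTensor]
      have := hpos P.1 P.2 t ht
      rwa [ha.isPOR_map, hb.isPOR_map, opProd, TensorProduct.map_comp] at this
    obtain ⟨y, hy⟩ := exists_eq_star_mul_self_of_evalGen _ h
    rw [LinearMap.comp_apply, LinearMap.comp_apply, hy]
    exact hs.2 y
  · rw [LinearMap.comp_apply, LinearMap.comp_apply, TensorProduct.map_tmul, ha.map_gen,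
      hb.map_gen, tensorCompletion.ofTensor_tmul]

/-- A commuting pair of representations turns the two families into unital completely positive maps
with commuting ranges, which are among the test maps for the commuting cone. -/
theorem exists_commTensor_state_of_maxTensor (ha : IsAlgebraicPOR G a) (hb : IsAlgebraicPOR K b)
    {s : MaxTensor A B →ₗ[ℂ] ℂ} (hs : s ∈ cstarStates (MaxTensor A B)) :
    ∃ s' ∈ (G.sgOrder.commTensor K.sgOrder).states,
      ∀ x y, s (tensorCompletion.tmul _ (a x) (b y)) = s' (G.gen x ⊗ₜ K.gen y) := by
  refine exists_state_of_tensorCompletion ha hb rfl (fun P _ t ht => ?_) hs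
  refine isPositive_of_inner_nonneg fun ξ => ?_
  have hcomm : ∀ c d, (ha.isPOR P.π).map c * (hb.isPOR P.ρ).map d =
      (hb.isPOR P.ρ).map d * (ha.isPOR P.π).map c := by
    rw [ha.isPOR_map, hb.isPOR_map]
    exact fun _ _ => P.comm _ _
  simpa using ht P.H _ _ (ha.isPOR P.π).isUCP_map (hb.isPOR P.ρ).isUCP_map hcomm fun _ => ξ

end Algebra

theorem exists_commTensor_state {G : Scenario V} {K : Scenario W} {z : V × W → ℂ}
    (hz : z ∈ maxStateFunctions G K) :
    ∃ s ∈ (G.sgOrder.commTensor K.sgOrder).states, z = pState G K s := by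
  obtain ⟨s, hs, rfl⟩ := hz
  have h := exists_commTensor_state_of_maxTensor G.isAlgebraicPOR_bgen K.isAlgebraicPOR_bgen hs
  obtain ⟨s', hs', h⟩ := h
  exact ⟨s', hs', funext fun z => h z.1 z.2⟩

end Restriction

/-! ### Tensor models -/

section TensorOperators

variable {E E' F F' : Type*} [NormedAddCommGroup E] [InnerProductSpace ℂ E]
  [NormedAddCommGroup E'] [InnerProductSpace ℂ E'] [NormedAddCommGroup F] [InnerProductSpace ℂ F]
  [NormedAddCommGroup F'] [InnerProductSpace ℂ F'] [CompleteSpace E] [CompleteSpace E']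
  [CompleteSpace F] [CompleteSpace F']

/-- This is `(S ⊗ T)* = S* ⊗ T*`, phrased through inner products because the algebraic tensor
product need not be complete. -/
theorem inner_mapL_left (S : E →L[ℂ] E') (T : F →L[ℂ] F') (ξ : E ⊗[ℂ] F) (η : E' ⊗[ℂ] F') :
    inner ℂ (TensorProduct.mapL S T ξ) η =
      inner ℂ ξ (TensorProduct.mapL (ContinuousLinearMap.adjoint S)
        (ContinuousLinearMap.adjoint T) η) := by
  induction ξ with
  | zero => simp
  | add ξ ξ' h h' => rw [map_add, inner_add_left, inner_add_left, h, h']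
  | tmul a b =>
    induction η with
    | zero => simp
    | add η η' h h' => rw [map_add, inner_add_right, inner_add_right, h, h']
    | tmul c d =>
      rw [TensorProduct.mapL_tmul, TensorProduct.mapL_tmul, TensorProduct.inner_tmul,
        TensorProduct.inner_tmul, ContinuousLinearMap.adjoint_inner_right,
        ContinuousLinearMap.adjoint_inner_right]

variable (E F) in
/-- The representation `T ↦ T ⊗ 1`. -/
def tensorLeft [CompleteSpace (E ⊗[ℂ] F)] : (E →L[ℂ] E) →⋆ₐ[ℂ] (E ⊗[ℂ] F →L[ℂ] E ⊗[ℂ] F) where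
  toFun T := TensorProduct.mapL T 1
  map_one' := TensorProduct.mapL_id_id
  map_mul' S T := by rw [← TensorProduct.mapL_mul, one_mul]
  map_zero' := by simp
  map_add' S T := TensorProduct.mapL_add_left S T 1
  commutes' c := by
    rw [Algebra.algebraMap_eq_smul_one, Algebra.algebraMap_eq_smul_one,
      TensorProduct.mapL_smul_left]
    exact congrArg _ TensorProduct.mapL_id_id
  map_star' T := by
    rw [ContinuousLinearMap.star_eq_adjoint, ContinuousLinearMap.star_eq_adjoint,
      ContinuousLinearMap.eq_adjoint_iff]
    intro ξ η
    rw [inner_mapL_left, ContinuousLinearMap.adjoint_adjoint, ← ContinuousLinearMap.star_eq_adjoint,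
      star_one]

variable (E F) in
/-- The representation `T ↦ 1 ⊗ T`. -/
def tensorRight [CompleteSpace (E ⊗[ℂ] F)] : (F →L[ℂ] F) →⋆ₐ[ℂ] (E ⊗[ℂ] F →L[ℂ] E ⊗[ℂ] F) where
  toFun T := TensorProduct.mapL 1 T
  map_one' := TensorProduct.mapL_id_id
  map_mul' S T := by rw [← TensorProduct.mapL_mul, one_mul]
  map_zero' := by simp
  map_add' S T := TensorProduct.mapL_add_right 1 S T
  commutes' c := by
    rw [Algebra.algebraMap_eq_smul_one, Algebra.algebraMap_eq_smul_one,
      TensorProduct.mapL_smul_right]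
    exact congrArg _ TensorProduct.mapL_id_id
  map_star' T := by
    rw [ContinuousLinearMap.star_eq_adjoint, ContinuousLinearMap.star_eq_adjoint,
      ContinuousLinearMap.eq_adjoint_iff]
    intro ξ η
    rw [inner_mapL_left, ContinuousLinearMap.adjoint_adjoint,
      ← ContinuousLinearMap.star_eq_adjoint 1, star_one]

theorem tensorLeft_mul_tensorRight [CompleteSpace (E ⊗[ℂ] F)] (S : E →L[ℂ] E) (T : F →L[ℂ] F) :
    tensorLeft E F S * tensorRight E F T = TensorProduct.mapL S T := by
  change TensorProduct.mapL S 1 * TensorProduct.mapL 1 T = _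
  rw [← TensorProduct.mapL_mul, mul_one, one_mul]

theorem tensorRight_mul_tensorLeft [CompleteSpace (E ⊗[ℂ] F)] (S : E →L[ℂ] E) (T : F →L[ℂ] F) :
    tensorRight E F T * tensorLeft E F S = TensorProduct.mapL S T := by
  change TensorProduct.mapL 1 T * TensorProduct.mapL S 1 = _
  rw [← TensorProduct.mapL_mul, mul_one, one_mul]

end TensorOperators

/-! ### Direct sums of operators and PORs on two Hilbert spaces -/

section DirectSum

variable (E F : Type) [NormedAddCommGroup E] [InnerProductSpace ℂ E]
  [NormedAddCommGroup F] [InnerProductSpace ℂ F]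

/-- The embedding of the first summand of `E ⊕ F`. -/
def sumInl : E →L[ℂ] WithLp 2 (E × F) :=
  (WithLp.prodContinuousLinearEquiv 2 ℂ E F).symm.toContinuousLinearMap ∘L
    ContinuousLinearMap.inl ℂ E F

/-- The embedding of the second summand of `E ⊕ F`. -/
def sumInr : F →L[ℂ] WithLp 2 (E × F) :=
  (WithLp.prodContinuousLinearEquiv 2 ℂ E F).symm.toContinuousLinearMap ∘L
    ContinuousLinearMap.inr ℂ E F

variable [CompleteSpace E] [CompleteSpace F]

theorem adjoint_sumInl : ContinuousLinearMap.adjoint (sumInl E F) =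
    ContinuousLinearMap.fst ℂ E F ∘L
      (WithLp.prodContinuousLinearEquiv 2 ℂ E F).toContinuousLinearMap := by
  refine ((ContinuousLinearMap.eq_adjoint_iff _ _).2 fun a b => ?_).symm
  rw [WithLp.prod_inner_apply]
  simp [sumInl]

theorem adjoint_sumInr : ContinuousLinearMap.adjoint (sumInr E F) =
    ContinuousLinearMap.snd ℂ E F ∘L
      (WithLp.prodContinuousLinearEquiv 2 ℂ E F).toContinuousLinearMap := by
  refine ((ContinuousLinearMap.eq_adjoint_iff _ _).2 fun a b => ?_).symm
  rw [WithLp.prod_inner_apply]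
  simp [sumInr]

variable {E F}

/-- The direct sum of two operators. -/
def sumOp (S : E →L[ℂ] E) (T : F →L[ℂ] F) : WithLp 2 (E × F) →L[ℂ] WithLp 2 (E × F) :=
  sumInl E F ∘L S ∘L ContinuousLinearMap.adjoint (sumInl E F) +
    sumInr E F ∘L T ∘L ContinuousLinearMap.adjoint (sumInr E F)

theorem sumOp_sumInl (S : E →L[ℂ] E) (T : F →L[ℂ] F) (ξ : E) :
    sumOp S T (sumInl E F ξ) = sumInl E F (S ξ) := by
  rw [sumOp, adjoint_sumInl, adjoint_sumInr]
  simp [sumInl, sumInr]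

theorem sumOp_sumInr (S : E →L[ℂ] E) (T : F →L[ℂ] F) (ξ : F) :
    sumOp S T (sumInr E F ξ) = sumInr E F (T ξ) := by
  rw [sumOp, adjoint_sumInl, adjoint_sumInr]
  simp [sumInl, sumInr]

theorem sumOp_one : sumOp (1 : E →L[ℂ] E) (1 : F →L[ℂ] F) = 1 := by
  rw [sumOp, adjoint_sumInl, adjoint_sumInr]
  ext1 ξ
  refine WithLp.ofLp_injective 2 ?_
  simp [sumInl, sumInr]
  rfl

theorem IsPOR.sumOp {V : Type} {G : Scenario V} {A : V → E →L[ℂ] E} {B : V → F →L[ℂ] F}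
    (hA : IsPOR G A) (hB : IsPOR G B) : IsPOR G fun x => sumOp (A x) (B x) := by
  refine ⟨fun x => ((hA.1 x).conj_adjoint _).add ((hB.1 x).conj_adjoint _), fun e he => ?_⟩
  rw [← sumOp_one, ← hA.2 e he, ← hB.2 e he]
  ext ξ : 1
  simp [Contextuality.sumOp, Finset.sum_add_distrib]

end DirectSum

/-! ### Finite dimensional tensor models and their convexity -/

section GenQ

variable {V W : Type} {G : Scenario V} {K : Scenario W}

theorem IsPOR.comp_starAlgHom {E F : Type} [NormedAddCommGroup E] [InnerProductSpace ℂ E]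
    [NormedAddCommGroup F] [InnerProductSpace ℂ F] [CompleteSpace E] [CompleteSpace F]
    {A : V → E →L[ℂ] E} (hA : IsPOR G A) (σ : (E →L[ℂ] E) →⋆ₐ[ℂ] (F →L[ℂ] F)) :
    IsPOR G fun x => σ (A x) := by
  refine ⟨fun x => ?_, fun e he => by rw [← map_sum, hA.2 e he, map_one]⟩
  obtain ⟨R, hR⟩ := exists_eq_adjoint_mul_self (hA.1 x)
  beta_reduce
  rw [hR, map_mul, map_star]
  exact ContinuousLinearMap.isPositive_adjoint_comp_self (σ R)

/-- The values of PORs on finite dimensional spaces in a unit vector of the tensor product form a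
tensor model. -/
theorem exists_mem_genQ {E F : Type} [NormedAddCommGroup E] [InnerProductSpace ℂ E]
    [NormedAddCommGroup F] [InnerProductSpace ℂ F] [FiniteDimensional ℂ E]
    [FiniteDimensional ℂ F] {A : V → E →L[ℂ] E} {B : W → F →L[ℂ] F} (hA : IsPOR G A)
    (hB : IsPOR K B) {ξ : E ⊗[ℂ] F} (hξ : ‖ξ‖ = 1) :
    ∃ p ∈ genQ G K, ∀ x y, (p (x, y) : ℂ) = inner ℂ ξ (TensorProduct.mapL (A x) (B y) ξ) := by
  have : CompleteSpace E := FiniteDimensional.complete ℂ E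
  have : CompleteSpace F := FiniteDimensional.complete ℂ F
  have : CompleteSpace (E ⊗[ℂ] F) := FiniteDimensional.complete ℂ _
  -- The amplifications `A_x ⊗ 1` and `1 ⊗ B_y` commute, so realness, positivity and no-signalling
  -- are inherited from the commuting case.
  obtain ⟨p, hp, hval⟩ := exists_mem_genQC (hA.comp_starAlgHom (tensorLeft E F))
    (hB.comp_starAlgHom (tensorRight E F))
    (fun x y => by rw [tensorLeft_mul_tensorRight, tensorRight_mul_tensorLeft]) hξ
  refine ⟨p, ⟨hp.1, E, inferInstance, inferInstance, F, inferInstance, inferInstance, A, B, ξ,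
    inferInstance, inferInstance, hA, hB, hξ, hval⟩, fun x y => ?_⟩
  rw [hval, tensorLeft_mul_tensorRight]

theorem exists_realisation_of_mem_genQ {p : V × W → ℝ} (hp : p ∈ genQ G K) :
    ∃ (H₁ : Type) (_ : NormedAddCommGroup H₁) (_ : InnerProductSpace ℂ H₁)
      (H₂ : Type) (_ : NormedAddCommGroup H₂) (_ : InnerProductSpace ℂ H₂)
      (_ : FiniteDimensional ℂ H₁) (_ : FiniteDimensional ℂ H₂)
      (A : V → H₁ →L[ℂ] H₁) (B : W → H₂ →L[ℂ] H₂) (ξ : H₁ ⊗[ℂ] H₂),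
      IsPOR G A ∧ IsPOR K B ∧ ‖ξ‖ = 1 ∧
      ∀ x y, (p (x, y) : ℂ) = inner ℂ ξ (TensorProduct.mapL (A x) (B y) ξ) := by
  obtain ⟨-, H₁, _, _, H₂, _, _, A, B, ξ, hf₁, hf₂, hA, hB, hξ, hval⟩ := hp
  refine ⟨H₁, _, _, H₂, _, _, hf₁, hf₂, A, B, ξ, hA, hB, hξ, fun x y => ?_⟩
  rw [hval, ← TensorProduct.mapL_mul, mul_one, one_mul]

/-- The corners `E ⊗ F` and `E' ⊗ F'` of `(E ⊕ E') ⊗ (F ⊕ F')` are orthogonal and invariant under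
tensor products of direct sum operators, so the cross terms vanish. -/
theorem inner_sum_tensor {E E' F F' : Type} [NormedAddCommGroup E] [InnerProductSpace ℂ E]
    [NormedAddCommGroup E'] [InnerProductSpace ℂ E'] [NormedAddCommGroup F]
    [InnerProductSpace ℂ F] [NormedAddCommGroup F'] [InnerProductSpace ℂ F'] [CompleteSpace E]
    [CompleteSpace E'] [CompleteSpace F] [CompleteSpace F'] (S : E →L[ℂ] E) (S' : E' →L[ℂ] E')
    (T : F →L[ℂ] F) (T' : F' →L[ℂ] F') (ξ : E ⊗[ℂ] F) (ξ' : E' ⊗[ℂ] F') :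
    inner ℂ (TensorProduct.mapL (sumInl E E') (sumInl F F') ξ +
        TensorProduct.mapL (sumInr E E') (sumInr F F') ξ')
      (TensorProduct.mapL (sumOp S S') (sumOp T T')
        (TensorProduct.mapL (sumInl E E') (sumInl F F') ξ +
          TensorProduct.mapL (sumInr E E') (sumInr F F') ξ')) =
      inner ℂ ξ (TensorProduct.mapL S T ξ) + inner ℂ ξ' (TensorProduct.mapL S' T' ξ') := by
  have e1 : TensorProduct.mapL (sumOp S S') (sumOp T T') ∘L
      TensorProduct.mapL (sumInl E E') (sumInl F F') =
      TensorProduct.mapL (sumInl E E') (sumInl F F') ∘L TensorProduct.mapL S T := by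
    rw [← TensorProduct.mapL_comp, ← TensorProduct.mapL_comp]
    congr 1 <;> ext1 ξ <;> exact sumOp_sumInl _ _ ξ
  have e2 : TensorProduct.mapL (sumOp S S') (sumOp T T') ∘L
      TensorProduct.mapL (sumInr E E') (sumInr F F') =
      TensorProduct.mapL (sumInr E E') (sumInr F F') ∘L TensorProduct.mapL S' T' := by
    rw [← TensorProduct.mapL_comp, ← TensorProduct.mapL_comp]
    congr 1 <;> ext1 ξ <;> exact sumOp_sumInr _ _ ξ
  have k1 : ∀ (E E' : Type) [NormedAddCommGroup E] [InnerProductSpace ℂ E]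
      [NormedAddCommGroup E'] [InnerProductSpace ℂ E'] [CompleteSpace E] [CompleteSpace E'],
      ContinuousLinearMap.adjoint (sumInl E E') ∘L sumInl E E' = 1 ∧
      ContinuousLinearMap.adjoint (sumInl E E') ∘L sumInr E E' = 0 ∧
      ContinuousLinearMap.adjoint (sumInr E E') ∘L sumInl E E' = 0 ∧
      ContinuousLinearMap.adjoint (sumInr E E') ∘L sumInr E E' = 1 := by
    intro E E' _ _ _ _ _ _
    rw [adjoint_sumInl, adjoint_sumInr]
    refine ⟨?_, ?_, ?_, ?_⟩ <;> ext ξ <;> simp [sumInl, sumInr]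
  have f1 : ∀ ζ, TensorProduct.mapL (sumOp S S') (sumOp T T')
      (TensorProduct.mapL (sumInl E E') (sumInl F F') ζ) =
      TensorProduct.mapL (sumInl E E') (sumInl F F') (TensorProduct.mapL S T ζ) :=
    fun ζ => congrArg (fun f => f ζ) e1
  have f2 : ∀ ζ, TensorProduct.mapL (sumOp S S') (sumOp T T')
      (TensorProduct.mapL (sumInr E E') (sumInr F F') ζ) =
      TensorProduct.mapL (sumInr E E') (sumInr F F') (TensorProduct.mapL S' T' ζ) :=
    fun ζ => congrArg (fun f => f ζ) e2
  rw [map_add, f1, f2]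
  simp only [inner_add_left, inner_add_right, inner_mapL_left, ← ContinuousLinearMap.comp_apply,
    ← TensorProduct.mapL_comp]
  simp [← ContinuousLinearMap.comp_assoc, k1, Module.End.one_eq_id]

theorem convex_genQ (G : Scenario V) (K : Scenario W) : Convex ℝ (genQ G K) := by
  intro p hp q hq α β hα hβ hαβ
  obtain ⟨E, _, _, F, _, _, _, _, A, B, ξ, hA, hB, hξ, hp'⟩ := exists_realisation_of_mem_genQ hp
  obtain ⟨E', _, _, F', _, _, _, _, A', B', ξ', hA', hB', hξ', hq'⟩ :=
    exists_realisation_of_mem_genQ hq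
  have : CompleteSpace E := FiniteDimensional.complete ℂ E
  have : CompleteSpace F := FiniteDimensional.complete ℂ F
  have : CompleteSpace E' := FiniteDimensional.complete ℂ E'
  have : CompleteSpace F' := FiniteDimensional.complete ℂ F'
  have hsq : ∀ (X : Type) [NormedAddCommGroup X] [InnerProductSpace ℂ X] (r : ℝ), 0 ≤ r →
      ∀ η η' : X, inner ℂ ((Real.sqrt r : ℂ) • η) ((Real.sqrt r : ℂ) • η') = r * inner ℂ η η' := by
    intro X _ _ r hr η η'
    rw [inner_smul_left, inner_smul_right, Complex.conj_ofReal, ← mul_assoc, ← Complex.ofReal_mul,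
      Real.mul_self_sqrt hr]
  -- The weights `√α`, `√β` enter quadratically, which produces the convex combination of the two
  -- models.
  let ζ : WithLp 2 (E × E') ⊗[ℂ] WithLp 2 (F × F') :=
    TensorProduct.mapL (sumInl E E') (sumInl F F') ((Real.sqrt α : ℂ) • ξ) +
      TensorProduct.mapL (sumInr E E') (sumInr F F') ((Real.sqrt β : ℂ) • ξ')
  have hval : ∀ (S : E →L[ℂ] E) (S' : E' →L[ℂ] E') (T : F →L[ℂ] F) (T' : F' →L[ℂ] F'),
      inner ℂ ζ (TensorProduct.mapL (sumOp S S') (sumOp T T') ζ) =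
      α * inner ℂ ξ (TensorProduct.mapL S T ξ) + β * inner ℂ ξ' (TensorProduct.mapL S' T' ξ') := by
    intro S S' T T'
    rw [inner_sum_tensor]
    rw [map_smul, map_smul]
    exact congrArg₂ (· + ·) (hsq (E ⊗[ℂ] F) α hα _ _) (hsq (E' ⊗[ℂ] F') β hβ _ _)
  have hone : ∀ (X Y : Type) [NormedAddCommGroup X] [InnerProductSpace ℂ X]
      [NormedAddCommGroup Y] [InnerProductSpace ℂ Y] (η : X ⊗[ℂ] Y),
      TensorProduct.mapL (1 : X →L[ℂ] X) (1 : Y →L[ℂ] Y) η = η :=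
    fun X Y _ _ _ _ η => congrArg (fun f : X ⊗[ℂ] Y →L[ℂ] X ⊗[ℂ] Y => f η) TensorProduct.mapL_id_id
  have hζ : ‖ζ‖ = 1 := by
    -- The same formula with identity operators computes `‖ζ‖² = α + β`.
    have h := hval 1 1 1 1
    rw [sumOp_one, sumOp_one, hone, hone, hone, inner_self_eq_norm_sq_to_K (x := ξ),
      inner_self_eq_norm_sq_to_K (x := ξ'), hξ, hξ'] at h
    rw [@norm_eq_sqrt_re_inner ℂ, h]
    simp [hαβ]
  obtain ⟨r, hr, hr'⟩ := exists_mem_genQ (hA.sumOp hA') (hB.sumOp hB') hζ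
  convert hr
  funext z
  apply Complex.ofReal_injective
  rw [hr' z.1 z.2, hval, ← hp', ← hq']
  simp

end GenQ

/-! ### States of minimal tensor products -/

section MinStates

variable {V W : Type} {G : Scenario V} {K : Scenario W}

@[simp] theorem opTensor_tmul {S T H₁ H₂ : Type} [AddCommGroup S] [Module ℂ S] [AddCommGroup T]
    [Module ℂ T] [NormedAddCommGroup H₁] [InnerProductSpace ℂ H₁] [NormedAddCommGroup H₂]
    [InnerProductSpace ℂ H₂] (φ : S →ₗ[ℂ] H₁ →L[ℂ] H₁) (ψ : T →ₗ[ℂ] H₂ →L[ℂ] H₂) (a : S) (b : T) :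
    opTensor φ ψ (a ⊗ₜ b) = TensorProduct.mapL (φ a) (ψ b) := rfl

theorem convex_genQA (G : Scenario V) (K : Scenario W) : Convex ℝ (genQA G K) :=
  (convex_genQ G K).closure

/-- The functions of the states of `S_G ⊗_min S_K` are approximately quantum models. -/
theorem exists_mem_genQA_of_minTensor_state [Fintype V] [Fintype W]
    {s : G.SG ⊗[ℂ] K.SG →ₗ[ℂ] ℂ} (hs : s ∈ (G.sgOrder.minTensor K.sgOrder).states) :
    ∃ p ∈ genQA G K, toComplex p = pState G K s := by
  refine exists_mem_of_state (convex_genQA G K) isClosed_closure ?_ ?_ hs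
  · intro x y k l φ ψ hφ hψ ξ
    have key := inner_nonneg_of_unit (T := TensorProduct.mapL (φ (G.gen x)) (ψ (K.gen y)))
      (fun ξ hξ => by
        obtain ⟨q, hq, hval⟩ := exists_mem_genQ hφ.isPOR hψ.isPOR hξ
        rw [← hval x y, Complex.zero_le_real]
        exact (hq.1.1.1 (x, y)).1) (ξ 0)
    simpa using key
  · intro c α h k l φ ψ hφ hψ ξ
    have key : ∀ η, 0 ≤ inner ℂ η ((∑ z : V × W,
        (c z : ℂ) • TensorProduct.mapL (φ (G.gen z.1)) (ψ (K.gen z.2)) - (α : ℂ) • 1) η) := by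
      refine fun η => inner_nonneg_of_unit (fun ξ hξ => ?_) η
      obtain ⟨q, hq, hval⟩ := exists_mem_genQ hφ.isPOR hψ.isPOR hξ
      -- The test maps are finite dimensional, so `q` lies in `genQ` before taking the closure.
      exact inner_combination hξ (fun z => hval z.1 z.2) (h q (subset_closure hq))
    have hone : opTensor φ ψ (G.sgOrder.minTensor K.sgOrder).one = 1 := by
      change TensorProduct.mapL (φ _) (ψ _) = 1
      rw [hφ.1, hψ.1]
      exact TensorProduct.mapL_id_id
    have hsum : opTensor φ ψ (∑ z : V × W, (c z : ℂ) • (G.gen z.1 ⊗ₜ[ℂ] K.gen z.2) -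
        (α : ℂ) • (G.sgOrder.minTensor K.sgOrder).one) = ∑ z : V × W,
        (c z : ℂ) • TensorProduct.mapL (φ (G.gen z.1)) (ψ (K.gen z.2)) - (α : ℂ) • 1 := by
      rw [map_sub, map_sum, map_smul, hone]
      simp only [map_smul, opTensor_tmul]
    have := key (ξ 0)
    rw [← hsum] at this
    simpa using this

/-- The compression of a POR by an isometry. -/
theorem IsPOR.compress {E H : Type} [NormedAddCommGroup E] [InnerProductSpace ℂ E]
    [NormedAddCommGroup H] [InnerProductSpace ℂ H] [CompleteSpace E] [CompleteSpace H]
    {A : V → H →L[ℂ] H} (hA : IsPOR G A) (v : E →ₗᵢ[ℂ] H) :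
    IsPOR G fun x => ContinuousLinearMap.adjoint v.toContinuousLinearMap ∘L A x ∘L
      v.toContinuousLinearMap := by
  refine ⟨fun x => (hA.1 x).adjoint_conj _, fun e he => ?_⟩
  have hv : ContinuousLinearMap.adjoint v.toContinuousLinearMap ∘L v.toContinuousLinearMap = 1 := by
    ext1 ξ
    refine ext_inner_right ℂ fun η => ?_
    rw [ContinuousLinearMap.comp_apply, ContinuousLinearMap.adjoint_inner_left]
    exact v.inner_map_map ξ η
  have h : ∀ ξ, ∑ x ∈ e, A x (v ξ) = v ξ := fun ξ => by
    rw [← sum_apply, hA.2 e he, one_apply_eq_self]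
  ext1 ξ
  simp [← map_sum, h]
  exact congrArg (fun T : E →L[ℂ] E => T ξ) hv

/-- Every element of a tensor product of Hilbert spaces comes from isometric images of finite
dimensional spaces. -/
theorem exists_isometries_tensor {H₁ H₂ : Type} [NormedAddCommGroup H₁] [InnerProductSpace ℂ H₁]
    [NormedAddCommGroup H₂] [InnerProductSpace ℂ H₂] (ζ : H₁ ⊗[ℂ] H₂) :
    ∃ (k l : ℕ) (v : EuclideanSpace ℂ (Fin k) →ₗᵢ[ℂ] H₁) (w : EuclideanSpace ℂ (Fin l) →ₗᵢ[ℂ] H₂)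
      (η : EuclideanSpace ℂ (Fin k) ⊗[ℂ] EuclideanSpace ℂ (Fin l)),
      ζ = TensorProduct.mapL v.toContinuousLinearMap w.toContinuousLinearMap η := by
  -- A tensor is a finite sum of elementary ones, so it lies in `M ⊗ N` for finite dimensional `M`,
  -- `N`; orthonormal bases identify these with Euclidean spaces.
  obtain ⟨M, N, _, _, h⟩ := TensorProduct.exists_finite_submodule_of_setFinite {ζ}
    (Set.finite_singleton ζ)
  obtain ⟨η, hη⟩ := h rfl
  let e := (stdOrthonormalBasis ℂ M).repr
  let f := (stdOrthonormalBasis ℂ N).repr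
  refine ⟨_, _, M.subtypeₗᵢ.comp e.symm.toLinearIsometry, N.subtypeₗᵢ.comp f.symm.toLinearIsometry,
    TensorProduct.map e.toLinearEquiv.toLinearMap f.toLinearEquiv.toLinearMap η, ?_⟩
  rw [TensorProduct.mapL_apply, ← LinearMap.comp_apply, ← TensorProduct.map_comp, ← hη,
    TensorProduct.mapIncl]
  congr 2
  · ext x
    simp [e]
  · ext x
    simp [f]

/-- Positivity in `S_G ⊗_min S_K` implies positivity for all pairs of PORs. -/
theorem inner_opTensor_nonneg {H₁ H₂ : Type} [NormedAddCommGroup H₁] [InnerProductSpace ℂ H₁]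
    [NormedAddCommGroup H₂] [InnerProductSpace ℂ H₂] [CompleteSpace H₁] [CompleteSpace H₂]
    {A : V → H₁ →L[ℂ] H₁} {B : W → H₂ →L[ℂ] H₂} (hA : IsPOR G A) (hB : IsPOR K B)
    {t : G.SG ⊗[ℂ] K.SG}
    (ht : (Matrix.of fun _ _ : Fin 1 => t) ∈ (G.sgOrder.minTensor K.sgOrder).cone 1)
    (ζ : H₁ ⊗[ℂ] H₂) : 0 ≤ inner ℂ ζ (opTensor hA.map hB.map t ζ) := by
  obtain ⟨k, l, v, w, η, rfl⟩ := exists_isometries_tensor ζ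
  have h := ht k l _ _ (hA.compress v).isUCP_map (hB.compress w).isUCP_map fun _ => η
  let f : G.SG ⊗[ℂ] K.SG →ₗ[ℂ] ℂ :=
    { toFun := fun t => inner ℂ
        (TensorProduct.mapL v.toContinuousLinearMap w.toContinuousLinearMap η)
        (opTensor hA.map hB.map t
          (TensorProduct.mapL v.toContinuousLinearMap w.toContinuousLinearMap η))
      map_add' := fun t u => by rw [map_add, add_apply, inner_add_right]
      map_smul' := fun c t => by rw [map_smul, smul_apply, inner_smul_right]; rfl }
  let g : G.SG ⊗[ℂ] K.SG →ₗ[ℂ] ℂ :=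
    { toFun := fun t => inner ℂ η (opTensor (hA.compress v).map (hB.compress w).map t η)
      map_add' := fun t u => by rw [map_add, add_apply, inner_add_right]
      map_smul' := fun c t => by rw [map_smul, smul_apply, inner_smul_right]; rfl }
  -- Both functionals are linear in `t`, and on generators they agree by moving `v ⊗ w` across the
  -- inner product.
  have hfg : f = g := by
    refine tensor_ext G K fun x y => ?_
    change inner ℂ (TensorProduct.mapL _ _ η) (opTensor hA.map hB.map (G.gen x ⊗ₜ K.gen y) _) =
      inner ℂ η (opTensor _ _ (G.gen x ⊗ₜ K.gen y) η)
    rw [opTensor_tmul, opTensor_tmul, hA.map_gen, hB.map_gen, IsPOR.map_gen, IsPOR.map_gen,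
      inner_mapL_left, TensorProduct.mapL_comp, TensorProduct.mapL_comp]
    rfl
  have : f t = g t := by rw [hfg]
  change 0 ≤ f t
  rw [this]
  have h' : 0 ≤ inner ℂ η (opTensor (hA.compress v).map (hB.compress w).map t η) := by
    simpa using h
  exact h'

theorem isPositive_of_denseRange {X H : Type} [NormedAddCommGroup H] [InnerProductSpace ℂ H]
    {T : H →L[ℂ] H} {J : X → H} (hJ : DenseRange J) (h : ∀ ζ, 0 ≤ inner ℂ (J ζ) (T (J ζ))) :
    T.IsPositive :=
  isPositive_of_inner_nonneg fun ξ => hJ.induction_on (p := fun ξ => 0 ≤ inner ℂ ξ (T ξ)) ξ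
    (isClosed_le continuous_const (continuous_id.inner T.continuous)) h

section Algebra

variable {A B : Type} [CStarAlgebra A] [CStarAlgebra B] {a : V → A} {b : W → B}

/-- `J` intertwines the product map on `P.H` with the tensor map on `H₁ ⊗ H₂`. Positivity need only
be checked on the dense range of `J`, that is, on vectors of the algebraic tensor product. -/
theorem exists_minTensor_state_of_spatial (ha : IsAlgebraicPOR G a) (hb : IsAlgebraicPOR K b)
    {s : MinTensor A B →ₗ[ℂ] ℂ} (hs : s ∈ cstarStates (MinTensor A B)) :
    ∃ s' ∈ (G.sgOrder.minTensor K.sgOrder).states,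
      ∀ x y, s (tensorCompletion.tmul _ (a x) (b y)) = s' (G.gen x ⊗ₜ K.gen y) := by
  refine exists_state_of_tensorCompletion ha hb rfl (fun P hP t ht => ?_) hs
  obtain ⟨H₁, _, _, _, H₂, _, _, _, π₀, ρ₀, J, hJ, hπ, hρ⟩ := hP
  have key : ∀ t ζ, opProd (ha.isPOR P.π).map (hb.isPOR P.ρ).map t (J ζ) =
      J (opTensor (ha.isPOR π₀).map (hb.isPOR ρ₀).map t ζ) := by
    intro t ζ
    induction ζ with
    | zero => simp
    | add ζ ζ' h h' => rw [map_add, map_add, map_add, map_add, h, h']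
    | tmul ξ η =>
      induction t with
      | zero => simp
      | add t u h h' => rw [map_add, map_add, add_apply, add_apply, map_add, h, h']
      | tmul c d =>
        rw [opProd_tmul, opTensor_tmul, ha.isPOR_map, hb.isPOR_map, ha.isPOR_map, hb.isPOR_map]
        change P.π _ (P.ρ _ (J (ξ ⊗ₜ η))) = J (π₀ _ ξ ⊗ₜ ρ₀ _ η)
        rw [hρ, hπ]
  refine isPositive_of_denseRange hJ fun ζ => ?_
  rw [key, J.inner_map_map]
  exact inner_opTensor_nonneg _ _ ht ζ

/-- When `H₁ ⊗ H₂` is already complete it carries the spatial representation itself, with the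
identity as `J`. -/
theorem exists_minTensor_vector_state {H₁ H₂ : Type} [NormedAddCommGroup H₁]
    [InnerProductSpace ℂ H₁] [NormedAddCommGroup H₂] [InnerProductSpace ℂ H₂]
    [CompleteSpace H₁] [CompleteSpace H₂] [CompleteSpace (H₁ ⊗[ℂ] H₂)]
    (π : A →⋆ₐ[ℂ] (H₁ →L[ℂ] H₁)) (ρ : B →⋆ₐ[ℂ] (H₂ →L[ℂ] H₂)) {ξ : H₁ ⊗[ℂ] H₂} (hξ : ‖ξ‖ = 1) :
    ∃ s ∈ cstarStates (MinTensor A B), ∀ a b, s (tensorCompletion.tmul _ a b) =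
      inner ℂ ξ (TensorProduct.mapL (π a) (ρ b) ξ) := by
  have : Nontrivial (H₁ ⊗[ℂ] H₂) := ⟨⟨ξ, 0, fun h => by simp [h] at hξ⟩⟩
  let P : CommRep A B :=
    { H := H₁ ⊗[ℂ] H₂
      π := (tensorLeft H₁ H₂).comp π
      ρ := (tensorRight H₁ H₂).comp ρ
      comm := fun a b => by
        change tensorLeft H₁ H₂ (π a) * tensorRight H₁ H₂ (ρ b) =
          tensorRight H₁ H₂ (ρ b) * tensorLeft H₁ H₂ (π a)
        rw [tensorLeft_mul_tensorRight, tensorRight_mul_tensorLeft] }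
  have hP : P.IsSpatial := ⟨H₁, inferInstance, inferInstance, inferInstance, H₂, inferInstance,
    inferInstance, inferInstance, π, ρ, LinearIsometry.id, Function.surjective_id.denseRange,
    fun _ _ _ => rfl, fun _ _ _ => rfl⟩
  obtain ⟨s, hs, h⟩ := tensorCompletion.exists_vector_state P hP (ξ := ξ) hξ
  refine ⟨s, hs, fun a b => ?_⟩
  rw [h, ← tensorLeft_mul_tensorRight]
  rfl

end Algebra

theorem exists_minTensor_cstarGen_state {𝔄 𝔅 : Type} [CStarAlgebra 𝔄] [CStarAlgebra 𝔅] {X : Set 𝔄}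
    {Y : Set 𝔅} {H₁ H₂ : Type} [NormedAddCommGroup H₁]
    [InnerProductSpace ℂ H₁] [NormedAddCommGroup H₂] [InnerProductSpace ℂ H₂]
    [CompleteSpace H₁] [CompleteSpace H₂] [CompleteSpace (H₁ ⊗[ℂ] H₂)]
    (π : 𝔄 →⋆ₐ[ℂ] (H₁ →L[ℂ] H₁)) (ρ : 𝔅 →⋆ₐ[ℂ] (H₂ →L[ℂ] H₂)) {ξ : H₁ ⊗[ℂ] H₂} (hξ : ‖ξ‖ = 1) :
    ∃ s ∈ cstarStates (MinTensor (cstarGen X) (cstarGen Y)),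
      ∀ a b, s (tensorCompletion.tmul _ a b) = inner ℂ ξ (TensorProduct.mapL (π a) (ρ b) ξ) :=
  exists_minTensor_vector_state (π.comp (cstarGen X).subtype) (ρ.comp (cstarGen Y).subtype) hξ

/-- The functions of the states of `B_G ⊗_min B_K`. -/
def minStateFunctions (G : Scenario V) (K : Scenario W) : Set (V × W → ℂ) :=
  {z | ∃ s ∈ cstarStates (MinTensor G.BG K.BG), z = pStateB G K s}

theorem toComplex_mem_minStateFunctions_of_mem_genQ {p : V × W → ℝ} (hp : p ∈ genQ G K) :
    toComplex p ∈ minStateFunctions G K := by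
  have hreal := exists_realisation_of_mem_genQ hp
  obtain ⟨E, _, _, F, _, _, _, _, A, B, ξ, hA, hB, hξ, hval⟩ := hreal
  have : CompleteSpace E := FiniteDimensional.complete ℂ E
  have : CompleteSpace F := FiniteDimensional.complete ℂ F
  have : CompleteSpace (E ⊗[ℂ] F) := FiniteDimensional.complete ℂ _
  -- Properness supplies the separability that `IsPOR.exists_rep` needs; nontriviality comes from `ξ
  -- ≠ 0`.
  have : ProperSpace E := FiniteDimensional.proper ℂ E
  have : ProperSpace F := FiniteDimensional.proper ℂ F
  have hξ0 : ξ ≠ 0 := fun h => by simp [h] at hξ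
  have : Nontrivial E := by
    by_contra h
    rw [not_nontrivial_iff_subsingleton] at h
    exact hξ0 (Subsingleton.elim _ _)
  have : Nontrivial F := by
    by_contra h
    rw [not_nontrivial_iff_subsingleton] at h
    exact hξ0 (Subsingleton.elim _ _)
  have hrepA := hA.exists_rep
  have hrepB := hB.exists_rep
  obtain ⟨π, hπ⟩ := hrepA
  obtain ⟨ρ, hρ⟩ := hrepB
  have hstate := exists_minTensor_cstarGen_state π ρ
    (X := Set.range fun x => G.g x x) (Y := Set.range fun y => K.g y y) hξ
  obtain ⟨s, hs, hval'⟩ := hstate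
  refine ⟨s, hs, funext fun z => (hval z.1 z.2).trans ?_⟩
  refine Eq.trans ?_ (hval' (G.bgen z.1) (K.bgen z.2)).symm
  change _ = inner ℂ ξ (TensorProduct.mapL (π (G.g z.1 z.1)) (ρ (K.g z.2 z.2)) ξ)
  rw [hπ, hρ]

theorem isClosed_tensorCompletion_state_values {A B : Type} [CStarAlgebra A] [CStarAlgebra B]
    (𝓕 : CommRep A B → Prop) (a : V → A) (b : W → B) :
    IsClosed {z : V × W → ℂ | ∃ s ∈ cstarStates (tensorCompletion A B 𝓕),
      z = fun i => s (tensorCompletion.tmul 𝓕 (a i.1) (b i.2))} := by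
  simpa only [funext_iff] using
    isClosed_state_values fun i : V × W => tensorCompletion.tmul 𝓕 (a i.1) (b i.2)

theorem isClosed_minStateFunctions (G : Scenario V) (K : Scenario W) :
    IsClosed (minStateFunctions G K) :=
  isClosed_tensorCompletion_state_values CommRep.IsSpatial G.bgen K.bgen

/-- Approximately quantum models are given by states of the minimal tensor product. -/
theorem toComplex_mem_minStateFunctions {p : V × W → ℝ} (hp : p ∈ genQA G K) :
    toComplex p ∈ minStateFunctions G K := by
  -- The functions of states form a closed set, so the inclusion passes from `genQ` to its closure.
  refine closure_minimal (fun q hq => toComplex_mem_minStateFunctions_of_mem_genQ hq)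
    ((isClosed_minStateFunctions G K).preimage continuous_toComplex) hp

theorem exists_minTensor_state {z : V × W → ℂ} (hz : z ∈ minStateFunctions G K) :
    ∃ s ∈ (G.sgOrder.minTensor K.sgOrder).states, z = pState G K s := by
  obtain ⟨s, hs, rfl⟩ := hz
  have h := exists_minTensor_state_of_spatial G.isAlgebraicPOR_bgen K.isAlgebraicPOR_bgen hs
  obtain ⟨s', hs', h⟩ := h
  exact ⟨s', hs', funext fun z => h z.1 z.2⟩

end MinStates

/-! ### The affine isomorphisms -/

section AffineIso

variable {V W : Type}

theorem convex_states {S : Type} [AddCommGroup S] [Module ℂ S] (O : MatrixOrder S) :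
    Convex ℝ O.states := by
  intro s hs t ht α β hα hβ hab
  refine ⟨?_, fun a ha => ?_⟩
  · simp only [LinearMap.add_apply, LinearMap.smul_apply, hs.1, ht.1]
    simpa using (by exact_mod_cast hab : (α : ℂ) + β = 1)
  · simp only [LinearMap.add_apply, LinearMap.smul_apply, Complex.real_smul]
    have hα' : (0 : ℂ) ≤ α := by exact_mod_cast hα
    have hβ' : (0 : ℂ) ≤ β := by exact_mod_cast hβ
    exact add_nonneg (mul_nonneg hα' (hs.2 a ha)) (mul_nonneg hβ' (ht.2 a ha))

/-- The elements `a_x ⊗ b_y` span the tensor product, so a functional is determined by its values on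
them. -/
theorem pState_injective (G : Scenario V) (K : Scenario W) : Function.Injective (pState G K) :=
  fun _ _ h => tensor_ext G K fun x y => congrFun h (x, y)

theorem isAffineIso_pState {G : Scenario V} {K : Scenario W} {O : MatrixOrder (G.SG ⊗[ℂ] K.SG)}
    {C : Set (V × W → ℝ)} (hC : Convex ℝ C)
    (h₁ : ∀ s ∈ O.states, ∃ p ∈ C, toComplex p = pState G K s)
    (h₂ : ∀ p ∈ C, ∃ s ∈ O.states, toComplex p = pState G K s) :
    IsAffineIso (pState G K) O.states (toComplex '' C) := by
  refine ⟨convex_states O, hC.linear_image (toComplexL : (V × W → ℝ) →ₗ[ℝ] _),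
    ⟨fun s hs => h₁ s hs, (pState_injective G K).injOn, ?_⟩, fun s _ t _ r _ => ?_⟩
  · rintro _ ⟨p, hp, rfl⟩
    obtain ⟨s, hs, h⟩ := h₂ p hp
    exact ⟨s, hs, h.symm⟩
  · ext z
    simp [pState]

theorem mem_of_toComplex_eq {C : Set (V × W → ℝ)} {f : V × W → ℂ}
    (h : ∃ q ∈ C, toComplex q = f) {p : V × W → ℝ} (hp : toComplex p = f) : p ∈ C := by
  obtain ⟨q, hq, h⟩ := h
  rwa [toComplex_injective (hp.trans h.symm)]

end AffineIso

end Contextuality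

end

/-! ### The main theorem -/

open Contextuality in
theorem mainTheorem3 {V W : Type} [Fintype V] [Fintype W] (G : Scenario V) (K : Scenario W)
    (hG : G.IsNontrivial) (hK : K.IsNontrivial) :
    (∀ p ∈ (G.prod K).models,
      [p ∈ genQC G K,
        ∃ s ∈ (G.sgOrder.commTensor K.sgOrder).states, toComplex p = pState G K s,
        ∃ s ∈ cstarStates (MaxTensor G.BG K.BG), toComplex p = pStateB G K s].TFAE) ∧
    (∀ p ∈ (G.prod K).models,
      [p ∈ genQA G K,
        ∃ s ∈ (G.sgOrder.minTensor K.sgOrder).states, toComplex p = pState G K s,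
        ∃ s ∈ cstarStates (MinTensor G.BG K.BG), toComplex p = pStateB G K s].TFAE) ∧
    IsAffineIso (pState G K) (G.sgOrder.commTensor K.sgOrder).states (toComplex '' genQC G K) ∧
    IsAffineIso (pState G K) (G.sgOrder.minTensor K.sgOrder).states (toComplex '' genQA G K) := by
  have c13 : ∀ p ∈ genQC G K, toComplex p ∈ maxStateFunctions G K :=
    fun p hp => toComplex_mem_maxStateFunctions hp
  have c32 : ∀ p : V × W → ℝ, toComplex p ∈ maxStateFunctions G K →
      ∃ s ∈ (G.sgOrder.commTensor K.sgOrder).states, toComplex p = pState G K s :=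
    fun p hp => exists_commTensor_state hp
  have m13 : ∀ p ∈ genQA G K, toComplex p ∈ minStateFunctions G K :=
    fun p hp => toComplex_mem_minStateFunctions hp
  have m32 : ∀ p : V × W → ℝ, toComplex p ∈ minStateFunctions G K →
      ∃ s ∈ (G.sgOrder.minTensor K.sgOrder).states, toComplex p = pState G K s :=
    fun p hp => exists_minTensor_state hp
  refine ⟨fun p _ => ?_, fun p _ => ?_,
    isAffineIso_pState (convex_genQC G K) (fun s hs => exists_mem_genQC_of_commTensor_state hs)
      fun p hp => c32 p (c13 p hp),
    isAffineIso_pState (convex_genQA G K) (fun s hs => exists_mem_genQA_of_minTensor_state hs)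
      fun p hp => m32 p (m13 p hp)⟩
  · tfae_have 1 → 3 := c13 p
    tfae_have 3 → 2 := c32 p
    tfae_have 2 → 1 := by
      rintro ⟨s, hs, h⟩
      exact mem_of_toComplex_eq (exists_mem_genQC_of_commTensor_state hs) h
    tfae_finish
  · tfae_have 1 → 3 := m13 p
    tfae_have 3 → 2 := m32 p
    tfae_have 2 → 1 := by
      rintro ⟨s, hs, h⟩
      exact mem_of_toComplex_eq (exists_mem_genQA_of_minTensor_state hs) h
    tfae_finish
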